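/- **Notation.** For $t>0$ put $\tau=it$ and let $\theta_1,\dots,\theta_4$ be the Jacobi theta functions $\theta_i(z|\tau)$ (so $\theta_3(z|\tau)=\sum_{n\in\mathbb Z}e^{2\pi i nz+\pi i n^2\tau}$). The torus with $K'/K=t$ has modulus $\theta_2(0|\tau)^2/\theta_3(0|\tau)^2$, quarter periods $K=\frac{\pi}{2}\theta_3(0|\tau)^2$ and $iK'=itK$; put $\Theta_i(X)=\theta_i(X/2K\,|\,\tau)$ and $\operatorname{sn}(X)=\frac{\theta_3(0|\tau)}{\theta_2(0|\tau)}\frac{\Theta_1(X)}{\Theta_4(X)}$. Let $0<q<1$. There is $t>0$ for which this modulus equals $q$; take any such $t$, with quarter periods $K,iK'$ of $\operatorname{sn}(\cdot\,;q)$. Let $k$ be the modulus for $2t$, with quarter periods $K_k$, $i\tilde K'_k=2itK_k$ of $\operatorname{sn}(\cdot\,;k)$ (up to the homothety $K_k/K$, the $k$-torus is the double cover of the $q$-torus: $\tilde K'_k=2\cdot\frac{K_k}{K}K'$). On $\mathbb Z^2$ let horizontal edges carry $\alpha$ and vertical edges $\beta$. The Q4 equation for a square with consecutive vertices $x_1,x_2,x_3,x_4$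 (edges $x_1x_2$, $x_3x_4$ carrying $\alpha$) is $$\operatorname{sn}(\alpha;k)(x_1x_2+x_3x_4)-\operatorname{sn}(\beta;k)(x_1x_4+x_2x_3)-\operatorname{sn}(\alpha-\beta;k)(x_1x_3+x_2x_4)+\operatorname{sn}(\alpha-\beta;k)\operatorname{sn}(\alpha;k)\operatorname{sn}(\beta;k)(1+k^2x_1x_2x_3x_4)=0.$$ With the theta functions $\Theta_i$ of the $k$-torus let $$F(X,Y,\alpha)=\frac{\Theta_2\Theta_3(\frac{X+Y+\alpha}2)}{\Theta_2\Theta_3(\frac{X+Y-\alpha}2)}\cdot\frac{\Theta_1\Theta_4(\frac{X-Y+\alpha}2)}{\Theta_1\Theta_4(\frac{X-Y-\alpha}2)},\qquad \Theta_i\Theta_j(v):=\Theta_i(v)\Theta_j(v).$$ For a vertex $(m,n)$ write $X=X_{m,n}$, $X_1=X_{m+1,n+1}$, $X_2=X_{m-1,n+1}$, $X_3=X_{m-1,n-1}$, $X_4=X_{m+1,n-1}$. The Laplace type equation of Q4 is $$F(X,X_1,\alpha-\beta)\,F(X,X_2,\beta-\alpha)\,F(X,X_3,\alpha-\beta)\,F(X,X_4,\beta-\alpha)=1.\tag{L}$$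 **Theorem.** (i) Three-leg form. Let $x_i=\operatorname{sn}(X_i;k)$ for $X_1,\dots,X_4\in\mathbb C$ (here the vertices of one square), let these and $\operatorname{sn}(\alpha;k),\operatorname{sn}(\beta;k),\operatorname{sn}(\alpha-\beta;k)$ be finite, and let all theta factors of $F(X_1,X_2,\alpha)$, $F(X_1,X_4,\beta)$, $F(X_1,X_3,\alpha-\beta)$ be nonzero. Then Q4 implies $F(X_1,X_2,\alpha)/F(X_1,X_4,\beta)=F(X_1,X_3,\alpha-\beta)$, and the converse holds if $x_1^2\ne1$ and $k^2x_1^2\neq1$. (ii) Let $X:\mathbb Z^2\to\mathbb C$ be such that $x=\operatorname{sn}(X;k)$ satisfies Q4 on the four squares at a vertex $(m,n)$, with all values $x$ on these squares and $\operatorname{sn}(\alpha;k),\operatorname{sn}(\beta;k),\operatorname{sn}(\alpha-\beta;k)$ finite and all theta factors nonzero in the eight legs from $(m,n)$ (parameter $\alpha$ to the horizontal neighbours, $\beta$ to the vertical ones, $\alpha-\beta$ to the diagonal ones). Then (L) holds at $(m,n)$. (iii) Let $\alpha-\beta=\frac{i}{2}\tilde K'_k=\frac{K_k}{K}\,iK'$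 (that is, $iK'$ up to the homothety), and let $m+n$ be even. Put $\varepsilon_{m,n}=1$ if $4\mid m+n$ and $\varepsilon_{m,n}=-1$ otherwise. The neighbours $v_k$ of $v=(m,n)$ are $(m\pm1,n\pm1)$. For every $\beta:\mathbb Z^2\to\mathbb C$ (ring variables, not to be confused with the edge parameter), the spherical ring pattern equation $$\prod_{v_k\sim v}\frac{\operatorname{sn}(\frac{\beta-\beta_k+iK'}2;q)}{\operatorname{sn}(\frac{\beta+\beta_k+iK'}2;q)}=1$$ holds at $v$ if and only if (L) holds at $v$ for $X_{m,n}=K_k+\frac{K_k}{K}(\beta_{m,n}+\varepsilon_{m,n}iK')$. (iv) Under the same assumptions, for every $\gamma:\mathbb Z^2\to\mathbb C$, the hyperbolic ring pattern equation $$\prod_{v_k\sim v}\frac{\operatorname{sn}(\frac{\gamma-\gamma_k+iK'}2;q)}{\operatorname{sn}(\frac{\gamma+\gamma_k-iK'}2;q)}=1$$ holds at $v$ if and only if (L) holds at $v$ for $X_{m,n}=K_k+\frac{K_k}{K}(\gamma_{m,n}+iK'+\varepsilon_{m,n}iK')$. In these product equations, "holds" includes that all factors are finite and nonzero. -/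

import Mathlib

open Complex

noncomputable section

/-! Jacobi theta functions `θ_i(z | τ)` in the normalization with real period `1` or `2`,
expressed through Mathlib's `jacobiTheta₂ z τ = ∑ n, exp (2πi n z + πi n² τ)`, which is `θ₃`. -/

/-- `θ₁(z|τ) = 2 ∑_{n ≥ 0} (-1)ⁿ exp(πiτ(n+1/2)²) sin((2n+1)πz)`. -/
def theta1 (z τ : ℂ) : ℂ :=
  -I * cexp (Real.pi * I * τ / 4 + Real.pi * I * z) * jacobiTheta₂ (z + 1 / 2 + τ / 2) τ

/-- `θ₂(z|τ) = 2 ∑_{n ≥ 0} exp(πiτ(n+1/2)²) cos((2n+1)πz)`. -/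
def theta2 (z τ : ℂ) : ℂ :=
  cexp (Real.pi * I * τ / 4 + Real.pi * I * z) * jacobiTheta₂ (z + τ / 2) τ

/-- `θ₃(z|τ) = 1 + 2 ∑_{n ≥ 1} exp(πiτn²) cos(2nπz)`. -/
def theta3 (z τ : ℂ) : ℂ := jacobiTheta₂ z τ

/-- `θ₄(z|τ) = 1 + 2 ∑_{n ≥ 1} (-1)ⁿ exp(πiτn²) cos(2nπz)`. -/
def theta4 (z τ : ℂ) : ℂ := jacobiTheta₂ (z + 1 / 2) τ

/-! A rectangular torus is described by the ratio `t = K'/K > 0` of its quarter periods,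
that is, by `τ = i t`. -/

/-- The period `τ = i t`. -/
def ellTau (t : ℝ) : ℂ := (t : ℂ) * I

/-- The modulus `θ₂(0|τ)² / θ₃(0|τ)²` of the Jacobi functions with `K'/K = t`. -/
def ellModulus (t : ℝ) : ℂ := (theta2 0 (ellTau t) / theta3 0 (ellTau t)) ^ 2

/-- The real quarter period `K = (π/2) θ₃(0|τ)²`. -/
def ellK (t : ℝ) : ℂ := Real.pi / 2 * theta3 0 (ellTau t) ^ 2

/-- The imaginary quarter period is `i K'` with `K' = t K`. -/
def ellK' (t : ℝ) : ℂ := (t : ℂ) * ellK t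

/-! Theta functions with rescaled argument, `Θ_i(X) = θ_i(X / (2K))`. -/

def bigTheta1 (t : ℝ) (X : ℂ) : ℂ := theta1 (X / (2 * ellK t)) (ellTau t)
def bigTheta2 (t : ℝ) (X : ℂ) : ℂ := theta2 (X / (2 * ellK t)) (ellTau t)
def bigTheta3 (t : ℝ) (X : ℂ) : ℂ := theta3 (X / (2 * ellK t)) (ellTau t)
def bigTheta4 (t : ℝ) (X : ℂ) : ℂ := theta4 (X / (2 * ellK t)) (ellTau t)

/-- The Jacobi function `sn(X; k) = Θ₁(X) / (√k Θ₄(X))` of modulus `k = ellModulus t`,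
where `√k = θ₂(0|τ) / θ₃(0|τ)`. Its poles are the zeros of `Θ₄`; the value there is `0`. -/
def jacobiSn (t : ℝ) (X : ℂ) : ℂ :=
  theta3 0 (ellTau t) / theta2 0 (ellTau t) * (bigTheta1 t X / bigTheta4 t X)

/-- `X` is not a pole of `sn`. -/
def SnFinite (t : ℝ) (X : ℂ) : Prop := bigTheta4 t X ≠ 0

/-- The left-hand side of the Q4 equation in Jacobi form, for an elementary square with
consecutive vertices `x₁, x₂, x₃, x₄`; the edges `x₁x₂`, `x₃x₄` carry `α` and the edges
`x₁x₄`, `x₂x₃` carry `β`. -/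
def Q4 (t : ℝ) (x₁ x₂ x₃ x₄ α β : ℂ) : ℂ :=
  jacobiSn t α * (x₁ * x₂ + x₃ * x₄)
    - jacobiSn t β * (x₁ * x₄ + x₂ * x₃)
    - jacobiSn t (α - β) * (x₁ * x₃ + x₂ * x₄)
    + jacobiSn t (α - β) * jacobiSn t α * jacobiSn t β
        * (1 + ellModulus t ^ 2 * (x₁ * x₂ * x₃ * x₄))

/-- The leg function of the three-leg form of Q4. It is nonzero exactly when all its theta
factors, in the numerator and in the denominator, are nonzero. -/
def legF (t : ℝ) (X Y α : ℂ) : ℂ :=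
  (bigTheta2 t ((X + Y + α) / 2) * bigTheta3 t ((X + Y + α) / 2))
      / (bigTheta2 t ((X + Y - α) / 2) * bigTheta3 t ((X + Y - α) / 2))
    * ((bigTheta1 t ((X - Y + α) / 2) * bigTheta4 t ((X - Y + α) / 2))
      / (bigTheta1 t ((X - Y - α) / 2) * bigTheta4 t ((X - Y - α) / 2)))

/-- The three-leg equation, centred at `X₁`. -/
def ThreeLeg (t : ℝ) (X₁ X₂ X₃ X₄ α β : ℂ) : Prop :=
  legF t X₁ X₂ α / legF t X₁ X₄ β = legF t X₁ X₃ (α - β)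

/-- The Q4 equation for the fields `x = sn X` on the elementary square of `ℤ²` with lower left
corner `(m, n)`; horizontal edges carry `α`, vertical edges carry `β`. -/
def Q4Square (t : ℝ) (α β : ℂ) (X : ℤ → ℤ → ℂ) (m n : ℤ) : Prop :=
  Q4 t (jacobiSn t (X m n)) (jacobiSn t (X (m + 1) n)) (jacobiSn t (X (m + 1) (n + 1)))
    (jacobiSn t (X m (n + 1))) α β = 0

/-- The Laplace type equation in multiplicative form at the vertex `(m, n)`. It relates the
field at this vertex to the fields at the four diagonal neighbours in `ℤ²`, which are its nearest
neighbours in the even (or odd) sublattice. If some theta factor vanishes, the left-hand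
side is `0`, so the equation includes that all its factors are finite and nonzero. -/
def LaplaceQ4 (t : ℝ) (α β : ℂ) (X : ℤ → ℤ → ℂ) (m n : ℤ) : Prop :=
  legF t (X m n) (X (m + 1) (n + 1)) (α - β)
    * legF t (X m n) (X (m - 1) (n + 1)) (β - α)
    * legF t (X m n) (X (m - 1) (n - 1)) (α - β)
    * legF t (X m n) (X (m + 1) (n - 1)) (β - α) = 1

/-- The four directions from a ring to the neighbouring (orthogonally intersecting) rings. -/
def ringDirections : Finset (ℤ × ℤ) := {(1, 1), (-1, 1), (-1, -1), (1, -1)}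

/-- The spherical ring pattern equation at the vertex `(m, n)`, for the modulus
`ellModulus t`. If some factor has a zero or a pole, the product is `0`, so the equation
includes that all factors are finite and nonzero. -/
def SphericalRing (t : ℝ) (b : ℤ → ℤ → ℂ) (m n : ℤ) : Prop :=
  ∏ d ∈ ringDirections,
    jacobiSn t ((b m n - b (m + d.1) (n + d.2) + I * ellK' t) / 2)
      / jacobiSn t ((b m n + b (m + d.1) (n + d.2) + I * ellK' t) / 2) = 1

/-- The hyperbolic ring pattern equation at the vertex `(m, n)` in the variables `γ`. -/
def HyperbolicRing (t : ℝ) (c : ℤ → ℤ → ℂ) (m n : ℤ) : Prop :=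
  ∏ d ∈ ringDirections,
    jacobiSn t ((c m n - c (m + d.1) (n + d.2) + I * ellK' t) / 2)
      / jacobiSn t ((c m n + c (m + d.1) (n + d.2) - I * ellK' t) / 2) = 1

/-- The black and white colouring of the lines `m + n = const` of the even sublattice:
`1` on black and `-1` on white vertices. -/
def lineColour (m n : ℤ) : ℂ := if 4 ∣ m + n then 1 else -1

/-- Passage from the ring variables `b`, on the torus with quarter periods
`K = ellK t`, `K' = ellK' t`, to the Q4 variables, on the double cover with quarter periods
`ellK (2t)`, `ellK' (2t)`: the shift by `± i K'` according to the colour, the homothety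
identifying the real quarter periods of both tori, and the shift by the real quarter period. -/
def toQ4Variables (t : ℝ) (b : ℤ → ℤ → ℂ) (m n : ℤ) : ℂ :=
  ellK (2 * t) + ellK (2 * t) / ellK t * (b m n + lineColour m n * (I * ellK' t))

end

/-! ### Half-period shifts and parity of the theta functions -/

/-! Everything rests on the Landen-type product formulas, which express a product of two theta
functions of period `τ` through theta functions of period `2τ` at the sum and the difference of the
arguments. Here `τ` belongs to the `q`-torus and `2τ` to its double cover, the `k`-torus. By these
formulas a leg is a quotient of products `θ₂ θ₁` of period `τ` (`legF_eq_theta`), and the same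
products are theta numerators of `sn(X ± A) - sn Y` on the `k`-torus (`legF_eq_snDiff`). The first
form serves the ring patterns, the second the three-leg form. Three-leg form: once denominators are
cleared, the equation is affine in each of `x₂, x₃, x₄`. Its eight coefficients are differences of
cubic theta products whose shifts `α, -β, -(α - β)` sum to zero. Cubic theta identities evaluate all
of them and give `2 θ₂ θ₃(X₁)` times the Q4 polynomial (`snDiff_three_leg`). The factor `θ₂ θ₃(X₁)`
can vanish only if `x₁² = 1` or `k² x₁² = 1`, which is why the converse needs these exclusions.
Laplace equation: in the alternating product of the four three-leg equations around a vertex, every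
horizontal and vertical leg cancels. Ring patterns: for `α - β = iK̃'_k/2` a leg and a factor of the
ring equation consist of the same `θ₁` values up to quasi-periodicity. Each leg is the inverse of
the ring factor times `-E` or `-E⁻¹`, where `E` depends only on the central vertex. Each case occurs
twice, so the `E` cancel. The hyperbolic equation is the spherical one shifted by `iK'`. Existence
of the torus is the intermediate value theorem for the modulus, which tends to `1` as `t → 0` and to
`0` as `t → ∞`. -/

theorem exp_pi_mul_I_div_two : cexp (Real.pi * I / 2) = I := by
  rw [show (Real.pi : ℂ) * I / 2 = Real.pi / 2 * I by ring]
  exact Complex.exp_pi_div_two_mul_I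

theorem theta3_add_half (z τ : ℂ) : theta3 (z + 1 / 2) τ = theta4 z τ := rfl

theorem theta4_add_half (z τ : ℂ) : theta4 (z + 1 / 2) τ = theta3 z τ := by
  rw [theta4, theta3, add_assoc, add_halves, jacobiTheta₂_add_left]

theorem theta2_add_half (z τ : ℂ) : theta2 (z + 1 / 2) τ = -theta1 z τ := by
  rw [theta2, theta1, show (Real.pi : ℂ) * I * τ / 4 + Real.pi * I * (z + 1 / 2)
    = (Real.pi * I * τ / 4 + Real.pi * I * z) + Real.pi * I / 2 by ring, Complex.exp_add,
    exp_pi_mul_I_div_two]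
  ring

theorem theta1_add_half (z τ : ℂ) : theta1 (z + 1 / 2) τ = theta2 z τ := by
  rw [theta2, theta1, show (Real.pi : ℂ) * I * τ / 4 + Real.pi * I * (z + 1 / 2)
    = (Real.pi * I * τ / 4 + Real.pi * I * z) + Real.pi * I / 2 by ring, Complex.exp_add,
    exp_pi_mul_I_div_two, show z + 1 / 2 + 1 / 2 + τ / 2 = z + τ / 2 + 1 by ring,
    jacobiTheta₂_add_left]
  linear_combination (-cexp (Real.pi * I * τ / 4 + Real.pi * I * z) *
    jacobiTheta₂ (z + τ / 2) τ) * I_mul_I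

theorem theta3_neg (z τ : ℂ) : theta3 (-z) τ = theta3 z τ := jacobiTheta₂_neg_left z τ

theorem theta4_neg (z τ : ℂ) : theta4 (-z) τ = theta4 z τ := by
  rw [theta4, theta4, ← jacobiTheta₂_neg_left, ← jacobiTheta₂_add_left]
  congr 1; ring

theorem theta2_neg (z τ : ℂ) : theta2 (-z) τ = theta2 z τ := by
  rw [theta2, theta2, ← jacobiTheta₂_neg_left (-z + τ / 2),
    show z + τ / 2 = -(-z + τ / 2) + τ by ring, jacobiTheta₂_add_left', ← mul_assoc,
    ← Complex.exp_add]
  congr 2; ring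

theorem theta1_neg (z τ : ℂ) : theta1 (-z) τ = -theta1 z τ := by
  rw [← theta2_add_half z, ← theta2_neg, neg_add, ← sub_eq_add_neg, ← theta1_add_half,
    sub_add_cancel]

theorem theta2_add_one (z τ : ℂ) : theta2 (z + 1) τ = -theta2 z τ := by
  rw [show z + 1 = z + 1 / 2 + 1 / 2 by ring, theta2_add_half, theta1_add_half]

theorem theta3_add_one (z τ : ℂ) : theta3 (z + 1) τ = theta3 z τ := jacobiTheta₂_add_left z τ

theorem theta1_zero (τ : ℂ) : theta1 0 τ = 0 := by
  have h := theta1_neg 0 τ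
  rw [neg_zero] at h
  exact self_eq_neg.mp h

theorem theta3_add_half_tau (z τ : ℂ) :
    theta3 (z + τ / 2) τ = cexp (-(Real.pi * I * τ / 4) - Real.pi * I * z) * theta2 z τ := by
  rw [theta2, ← mul_assoc, ← Complex.exp_add, theta3,
    show -(Real.pi * I * τ / 4) - Real.pi * I * z + (Real.pi * I * τ / 4 + Real.pi * I * z) = 0
      by ring, Complex.exp_zero, one_mul]

theorem theta2_add_half_tau (z τ : ℂ) :
    theta2 (z + τ / 2) τ = cexp (-(Real.pi * I * τ / 4) - Real.pi * I * z) * theta3 z τ := by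
  rw [theta2, theta3, add_assoc, add_halves, jacobiTheta₂_add_left', ← mul_assoc,
    ← Complex.exp_add]
  congr 2; ring

theorem exp_shift_add_half (z τ : ℂ) :
    cexp (-(Real.pi * I * τ / 4) - Real.pi * I * (z + 1 / 2)) =
      -I * cexp (-(Real.pi * I * τ / 4) - Real.pi * I * z) := by
  rw [show -(Real.pi * I * τ / 4) - Real.pi * I * (z + 1 / 2) =
    -(Real.pi * I / 2) + (-(Real.pi * I * τ / 4) - Real.pi * I * z) by ring, Complex.exp_add,
    Complex.exp_neg, exp_pi_mul_I_div_two, Complex.inv_I]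

/-- `θ₄` is `θ₁` shifted by half of the imaginary period. -/
theorem theta1_add_half_tau (z τ : ℂ) :
    theta1 (z + τ / 2) τ = I * cexp (-(Real.pi * I * τ / 4) - Real.pi * I * z) * theta4 z τ := by
  have h := theta2_add_half_tau (z + 1 / 2) τ
  rw [add_right_comm, theta2_add_half, theta3_add_half, exp_shift_add_half] at h
  linear_combination -h

theorem theta4_add_half_tau (z τ : ℂ) :
    theta4 (z + τ / 2) τ = I * cexp (-(Real.pi * I * τ / 4) - Real.pi * I * z) * theta1 z τ := by
  have h := theta3_add_half_tau (z + 1 / 2) τ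
  rw [add_right_comm, theta2_add_half, theta3_add_half, exp_shift_add_half] at h
  linear_combination h

/-! ### Products of theta functions with period `τ` in terms of those with period `2τ` -/

/-- Pairs of integers of equal parity, together with those of different parity. -/
def sumDiffEquiv : (ℤ × ℤ) ⊕ (ℤ × ℤ) ≃ ℤ × ℤ where
  toFun := Sum.elim (fun p => (p.1 + p.2, p.1 - p.2)) (fun p => (p.1 + p.2 + 1, p.1 - p.2))
  -- In the odd case both the sum and the difference are odd, and integer division by `2` rounds
  -- down, which removes exactly the `+ 1` of `toFun`.
  invFun p := if Even (p.1 + p.2) then Sum.inl ((p.1 + p.2) / 2, (p.1 - p.2) / 2)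
    else Sum.inr ((p.1 + p.2) / 2, (p.1 - p.2) / 2)
  left_inv := by
    rintro (⟨a, b⟩ | ⟨a, b⟩)
    · have h : Even (a + b + (a - b)) := ⟨a, by ring⟩
      simp only [Sum.elim_inl, h, if_true, Sum.inl.injEq, Prod.mk.injEq]
      omega
    · have h : ¬Even (a + b + 1 + (a - b)) := by rw [Int.even_iff]; omega
      simp only [Sum.elim_inr, h, if_false, Sum.inr.injEq, Prod.mk.injEq]
      omega
  right_inv := by
    rintro ⟨a, b⟩
    by_cases h : Even (a + b)
    · simp only [h, if_true, Sum.elim_inl, Prod.mk.injEq]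
      rw [Int.even_iff] at h; omega
    · simp only [h, if_false, Sum.elim_inr, Prod.mk.injEq]
      rw [Int.even_iff] at h; omega

theorem hasSum_jacobiTheta₂_mul (x y : ℂ) {τ : ℂ} (hτ : 0 < τ.im) :
    HasSum (fun p : ℤ × ℤ => jacobiTheta₂_term p.1 x τ * jacobiTheta₂_term p.2 y τ)
      (jacobiTheta₂ x τ * jacobiTheta₂ y τ) := by
  have hx := hasSum_jacobiTheta₂_term x hτ
  have hy := hasSum_jacobiTheta₂_term y hτ
  have hxy := summable_mul_of_summable_norm hx.summable.norm hy.summable.norm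
  rw [jacobiTheta₂, jacobiTheta₂, hx.summable.tsum_mul_tsum hy.summable hxy]
  exact hxy.hasSum

theorem two_mul_im_pos {τ : ℂ} (hτ : 0 < τ.im) : 0 < (2 * τ).im := by
  simpa using hτ

/-- Substituting `(p + q, p - q)` or `(p + q + 1, p - q)` for the summation indices turns `n₁² +
n₂²` into `2(p² + q²)`, with `p, q` both integers or both half-integers. This doubles `τ` and gives
the `θ₃` and the `θ₂` term. The other product formulas follow by half-period shifts. -/
theorem theta3_mul_theta3 (x y : ℂ) {τ : ℂ} (hτ : 0 < τ.im) :
    theta3 x τ * theta3 y τ = theta3 (x + y) (2 * τ) * theta3 (x - y) (2 * τ)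
      + theta2 (x + y) (2 * τ) * theta2 (x - y) (2 * τ) := by
  have hT := two_mul_im_pos hτ
  have h := sumDiffEquiv.hasSum_iff.mpr (hasSum_jacobiTheta₂_mul x y hτ)
  refine h.unique (HasSum.sum ?_ ?_)
  · convert! hasSum_jacobiTheta₂_mul (x + y) (x - y) hT using 1
    ext ⟨p, q⟩
    simp only [Function.comp_apply, sumDiffEquiv, Equiv.coe_fn_mk, Sum.elim_inl,
      jacobiTheta₂_term, ← Complex.exp_add]
    congr 1
    push_cast
    ring
  · rw [theta2, theta2, mul_mul_mul_comm]
    convert! (hasSum_jacobiTheta₂_mul (x + y + 2 * τ / 2) (x - y + 2 * τ / 2) hT).mul_left _ using 1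
    ext ⟨p, q⟩
    simp only [Function.comp_apply, sumDiffEquiv, Equiv.coe_fn_mk, Sum.elim_inr,
      jacobiTheta₂_term, ← Complex.exp_add]
    congr 1
    push_cast
    ring

theorem theta4_mul_theta4 (x y : ℂ) {τ : ℂ} (hτ : 0 < τ.im) :
    theta4 x τ * theta4 y τ = theta3 (x + y) (2 * τ) * theta3 (x - y) (2 * τ)
      - theta2 (x + y) (2 * τ) * theta2 (x - y) (2 * τ) := by
  rw [← theta3_add_half, ← theta3_add_half, theta3_mul_theta3 _ _ hτ,
    show x + 1 / 2 + (y + 1 / 2) = x + y + 1 by ring, add_sub_add_right_eq_sub,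
    theta3_add_one, theta2_add_one]
  ring

theorem theta3_mul_theta4 (x y : ℂ) {τ : ℂ} (hτ : 0 < τ.im) :
    theta3 x τ * theta4 y τ = theta4 (x + y) (2 * τ) * theta4 (x - y) (2 * τ)
      - theta1 (x + y) (2 * τ) * theta1 (x - y) (2 * τ) := by
  have h := theta2_add_half (-(x - y)) (2 * τ)
  have h' := theta3_add_half (-(x - y)) (2 * τ)
  rw [theta1_neg] at h
  rw [theta4_neg] at h'
  rw [← theta3_add_half y, theta3_mul_theta3 _ _ hτ, ← add_assoc, theta3_add_half, theta2_add_half,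
    ← theta3_neg (x - _), ← theta2_neg (x - _),
    show -(x - (y + 1 / 2)) = -(x - y) + 1 / 2 by ring, h, h']
  ring

theorem theta2_mul_theta2 (x y : ℂ) {τ : ℂ} (hτ : 0 < τ.im) :
    theta2 x τ * theta2 y τ = theta3 (x + y) (2 * τ) * theta2 (x - y) (2 * τ)
      + theta2 (x + y) (2 * τ) * theta3 (x - y) (2 * τ) := by
  have h := theta3_mul_theta3 (x + τ / 2) (y + τ / 2) hτ
  have e : cexp (-(Real.pi * I * (2 * τ) / 4) - Real.pi * I * (x + y)) =
      cexp (-(Real.pi * I * τ / 4) - Real.pi * I * x) *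
        cexp (-(Real.pi * I * τ / 4) - Real.pi * I * y) := by
    rw [← Complex.exp_add]
    congr 1; ring
  -- The shifts by `τ/2` add up to half of the period `2τ` in the sum and cancel in the difference.
  rw [show x + τ / 2 + (y + τ / 2) = x + y + 2 * τ / 2 by ring, add_sub_add_right_eq_sub,
    theta3_add_half_tau, theta3_add_half_tau, theta3_add_half_tau, theta2_add_half_tau, e] at h
  apply mul_left_cancel₀ (mul_ne_zero
    (Complex.exp_ne_zero (-(Real.pi * I * τ / 4) - Real.pi * I * x))
    (Complex.exp_ne_zero (-(Real.pi * I * τ / 4) - Real.pi * I * y)))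
  linear_combination h

theorem theta1_mul_theta1 (x y : ℂ) {τ : ℂ} (hτ : 0 < τ.im) :
    theta1 x τ * theta1 y τ = theta3 (x + y) (2 * τ) * theta2 (x - y) (2 * τ)
      - theta2 (x + y) (2 * τ) * theta3 (x - y) (2 * τ) := by
  have h := theta2_mul_theta2 (x + 1 / 2) (y + 1 / 2) hτ
  rw [show x + 1 / 2 + (y + 1 / 2) = x + y + 1 by ring, add_sub_add_right_eq_sub,
    theta3_add_one, theta2_add_one, theta2_add_half, theta2_add_half] at h
  linear_combination h

theorem theta1_mul_theta2 (x y : ℂ) {τ : ℂ} (hτ : 0 < τ.im) :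
    theta1 x τ * theta2 y τ = theta1 (x + y) (2 * τ) * theta4 (x - y) (2 * τ)
      + theta4 (x + y) (2 * τ) * theta1 (x - y) (2 * τ) := by
  have h := theta2_mul_theta2 (x + 1 / 2) y hτ
  rw [add_right_comm, add_sub_right_comm,
    theta3_add_half, theta2_add_half, theta3_add_half, theta2_add_half, theta2_add_half] at h
  linear_combination -h

/-! ### Quartic and cubic relations -/

theorem theta1_mul_theta1_of {x y s d τ : ℂ} (hτ : 0 < τ.im) (hs : x + y = s) (hd : x - y = d) :
    theta1 x τ * theta1 y τ = theta3 s (2 * τ) * theta2 d (2 * τ)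
      - theta2 s (2 * τ) * theta3 d (2 * τ) := by
  rw [← hs, ← hd, theta1_mul_theta1 _ _ hτ]

theorem theta4_mul_theta4_of {x y s d τ : ℂ} (hτ : 0 < τ.im) (hs : x + y = s) (hd : x - y = d) :
    theta4 x τ * theta4 y τ = theta3 s (2 * τ) * theta3 d (2 * τ)
      - theta2 s (2 * τ) * theta2 d (2 * τ) := by
  rw [← hs, ← hd, theta4_mul_theta4 _ _ hτ]

/-- The duplication formula: the products `θ₁ θ₂` at `(2x, 0)`, `θ₁ θ₂` at `(x, x)` and `θ₃ θ₄` at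
`(x, x)` all reduce to `θ₁` and `θ₄` of period `2τ` at `2x`. -/
theorem theta1_two_mul {τ : ℂ} (hτ : 0 < τ.im) (x : ℂ) :
    theta2 0 τ * theta4 0 (2 * τ) ^ 2 * theta1 (2 * x) τ =
      2 * (theta1 x τ * theta2 x τ * theta3 x τ * theta4 x τ) := by
  have h1 := theta1_mul_theta2 (2 * x) 0 hτ
  have h2 := theta1_mul_theta2 x x hτ
  have h3 := theta3_mul_theta4 x x hτ
  rw [add_zero, sub_zero] at h1
  rw [sub_self, ← two_mul, theta1_zero] at h2 h3
  linear_combination theta4 0 (2 * τ) ^ 2 * h1 - 2 * theta3 x τ * theta4 x τ * h2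
    - 2 * theta1 (2 * x) (2 * τ) * theta4 0 (2 * τ) * h3

/-- The extra factor `θ₄(x)` allows the theta functions to be paired. Since `b + c = -a`, the pairs
involve only the arguments `2x ± a`, `a` and `b - c` at period `2τ`, and the difference of the two
products factors. The three quartic relations below follow the same pattern. -/
theorem theta4_quartic_444 {τ : ℂ} (hτ : 0 < τ.im) (x : ℂ) {a b c : ℂ}
    (h : a + b + c = 0) :
    theta4 x τ * (theta4 (x + a) τ * theta4 (x + b) τ * theta4 (x + c) τ
      - theta4 (x - a) τ * theta4 (x - b) τ * theta4 (x - c) τ)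
      = -(theta1 (2 * x) τ * (theta1 a τ * theta1 b τ * theta1 c τ)) := by
  have h1 := theta4_mul_theta4_of (x := x + a) (y := x) hτ (s := 2 * x + a) (d := a)
    (by ring) (by ring)
  have h2 := theta4_mul_theta4_of (x := x + b) (y := x + c) hτ (s := 2 * x - a) (d := b - c)
    (by linear_combination h) (by ring)
  have h3 := theta4_mul_theta4_of (x := x) (y := x - a) hτ (s := 2 * x - a) (d := a)
    (by ring) (by ring)
  have h4 := theta4_mul_theta4_of (x := x - c) (y := x - b) hτ (s := 2 * x + a) (d := b - c)
    (by linear_combination -h) (by ring)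
  have h5 := theta1_mul_theta1 (2 * x) a hτ
  have h6 := theta1_mul_theta1_of (x := b) (y := c) hτ (s := -a) (d := b - c)
    (by linear_combination h) rfl
  rw [theta2_neg, theta3_neg] at h6
  calc _ = (theta4 (x + a) τ * theta4 x τ) * (theta4 (x + b) τ * theta4 (x + c) τ)
      - (theta4 x τ * theta4 (x - a) τ) * (theta4 (x - c) τ * theta4 (x - b) τ) := by ring
    _ = -((theta1 (2 * x) τ * theta1 a τ) * (theta1 b τ * theta1 c τ)) := by
      rw [h1, h2, h3, h4, h5, h6]; ring
    _ = _ := by ring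

theorem theta1_quartic_111 {τ : ℂ} (hτ : 0 < τ.im) (x : ℂ) {a b c : ℂ}
    (h : a + b + c = 0) :
    theta1 x τ * (theta1 (x + a) τ * theta1 (x + b) τ * theta1 (x + c) τ
      - theta1 (x - a) τ * theta1 (x - b) τ * theta1 (x - c) τ)
      = theta1 (2 * x) τ * (theta1 a τ * theta1 b τ * theta1 c τ) := by
  have h1 := theta1_mul_theta1_of (x := x + a) (y := x) hτ (s := 2 * x + a) (d := a)
    (by ring) (by ring)
  have h2 := theta1_mul_theta1_of (x := x + b) (y := x + c) hτ (s := 2 * x - a) (d := b - c)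
    (by linear_combination h) (by ring)
  have h3 := theta1_mul_theta1_of (x := x) (y := x - a) hτ (s := 2 * x - a) (d := a)
    (by ring) (by ring)
  have h4 := theta1_mul_theta1_of (x := x - c) (y := x - b) hτ (s := 2 * x + a) (d := b - c)
    (by linear_combination -h) (by ring)
  have h5 := theta1_mul_theta1 (2 * x) a hτ
  have h6 := theta1_mul_theta1_of (x := b) (y := c) hτ (s := -a) (d := b - c)
    (by linear_combination h) rfl
  rw [theta2_neg, theta3_neg] at h6
  calc _ = (theta1 (x + a) τ * theta1 x τ) * (theta1 (x + b) τ * theta1 (x + c) τ)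
      - (theta1 x τ * theta1 (x - a) τ) * (theta1 (x - c) τ * theta1 (x - b) τ) := by ring
    _ = (theta1 (2 * x) τ * theta1 a τ) * (theta1 b τ * theta1 c τ) := by
      rw [h1, h2, h3, h4, h5, h6]; ring
    _ = _ := by ring

theorem theta1_quartic_144 {τ : ℂ} (hτ : 0 < τ.im) (x : ℂ) {a b c : ℂ}
    (h : a + b + c = 0) :
    theta1 x τ * (theta1 (x + a) τ * theta4 (x + b) τ * theta4 (x + c) τ
      - theta1 (x - a) τ * theta4 (x - b) τ * theta4 (x - c) τ)
      = theta1 (2 * x) τ * (theta1 a τ * theta4 b τ * theta4 c τ) := by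
  have h1 := theta1_mul_theta1_of (x := x + a) (y := x) hτ (s := 2 * x + a) (d := a)
    (by ring) (by ring)
  have h2 := theta4_mul_theta4_of (x := x + b) (y := x + c) hτ (s := 2 * x - a) (d := b - c)
    (by linear_combination h) (by ring)
  have h3 := theta1_mul_theta1_of (x := x) (y := x - a) hτ (s := 2 * x - a) (d := a)
    (by ring) (by ring)
  have h4 := theta4_mul_theta4_of (x := x - c) (y := x - b) hτ (s := 2 * x + a) (d := b - c)
    (by linear_combination -h) (by ring)
  have h5 := theta1_mul_theta1 (2 * x) a hτ
  have h6 := theta4_mul_theta4_of (x := b) (y := c) hτ (s := -a) (d := b - c)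
    (by linear_combination h) rfl
  rw [theta2_neg, theta3_neg] at h6
  calc _ = (theta1 (x + a) τ * theta1 x τ) * (theta4 (x + b) τ * theta4 (x + c) τ)
      - (theta1 x τ * theta1 (x - a) τ) * (theta4 (x - c) τ * theta4 (x - b) τ) := by ring
    _ = (theta1 (2 * x) τ * theta1 a τ) * (theta4 b τ * theta4 c τ) := by
      rw [h1, h2, h3, h4, h5, h6]; ring
    _ = _ := by ring

theorem theta4_quartic_411 {τ : ℂ} (hτ : 0 < τ.im) (x : ℂ) {a b c : ℂ}
    (h : a + b + c = 0) :
    theta4 x τ * (theta4 (x + a) τ * theta1 (x + b) τ * theta1 (x + c) τ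
      - theta4 (x - a) τ * theta1 (x - b) τ * theta1 (x - c) τ)
      = -(theta1 (2 * x) τ * (theta1 a τ * theta4 b τ * theta4 c τ)) := by
  have h1 := theta4_mul_theta4_of (x := x + a) (y := x) hτ (s := 2 * x + a) (d := a)
    (by ring) (by ring)
  have h2 := theta1_mul_theta1_of (x := x + b) (y := x + c) hτ (s := 2 * x - a) (d := b - c)
    (by linear_combination h) (by ring)
  have h3 := theta4_mul_theta4_of (x := x) (y := x - a) hτ (s := 2 * x - a) (d := a)
    (by ring) (by ring)
  have h4 := theta1_mul_theta1_of (x := x - c) (y := x - b) hτ (s := 2 * x + a) (d := b - c)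
    (by linear_combination -h) (by ring)
  have h5 := theta1_mul_theta1 (2 * x) a hτ
  have h6 := theta4_mul_theta4_of (x := b) (y := c) hτ (s := -a) (d := b - c)
    (by linear_combination h) rfl
  rw [theta2_neg, theta3_neg] at h6
  calc _ = (theta4 (x + a) τ * theta4 x τ) * (theta1 (x + b) τ * theta1 (x + c) τ)
      - (theta4 x τ * theta4 (x - a) τ) * (theta1 (x - c) τ * theta1 (x - b) τ) := by ring
    _ = -((theta1 (2 * x) τ * theta1 a τ) * (theta4 b τ * theta4 c τ)) := by
      rw [h1, h2, h3, h4, h5, h6]; ring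
    _ = _ := by ring

/-! ### From quartic to cubic relations: cancelling a theta factor among entire functions. -/

theorem differentiable_jacobiTheta₂_fst {τ : ℂ} (hτ : 0 < τ.im) :
    Differentiable ℂ (fun z => jacobiTheta₂ z τ) :=
  fun z => differentiableAt_jacobiTheta₂_fst z hτ

theorem differentiable_theta1 {τ : ℂ} (hτ : 0 < τ.im) : Differentiable ℂ (theta1 · τ) := by
  have h := (differentiable_jacobiTheta₂_fst hτ).comp
    (show Differentiable ℂ fun z : ℂ => z + 1 / 2 + τ / 2 by fun_prop)
  exact .mul (by fun_prop) h

theorem differentiable_theta2 {τ : ℂ} (hτ : 0 < τ.im) : Differentiable ℂ (theta2 · τ) := by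
  have h := (differentiable_jacobiTheta₂_fst hτ).comp
    (show Differentiable ℂ fun z : ℂ => z + τ / 2 by fun_prop)
  exact .mul (by fun_prop) h

theorem differentiable_theta3 {τ : ℂ} (hτ : 0 < τ.im) : Differentiable ℂ (theta3 · τ) :=
  differentiable_jacobiTheta₂_fst hτ

theorem differentiable_theta4 {τ : ℂ} (hτ : 0 < τ.im) : Differentiable ℂ (theta4 · τ) :=
  (differentiable_jacobiTheta₂_fst hτ).comp
    (show Differentiable ℂ fun z : ℂ => z + 1 / 2 by fun_prop)

theorem eq_zero_of_entire_mul_eq_zero {u f : ℂ → ℂ} (hu : Differentiable ℂ u)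
    (hf : Differentiable ℂ f) (h : ∀ x, u x * f x = 0) {x₀ : ℂ} (hx₀ : u x₀ ≠ 0) (x : ℂ) :
    f x = 0 := by
  have hu' : AnalyticOnNhd ℂ u Set.univ := fun z _ => hu.analyticAt z
  have hf' : AnalyticOnNhd ℂ f Set.univ := fun z _ => hf.analyticAt z
  rcases hu'.eq_zero_or_eq_zero_of_mul_eq_zero hf' (fun z _ => h z) isPreconnected_univ with h | h
  · exact absurd (h x₀ (Set.mem_univ _)) hx₀
  · exact h x (Set.mem_univ _)

theorem theta4_half_ne_zero {τ : ℂ} (h0 : theta3 0 τ ≠ 0) : theta4 (1 / 2) τ ≠ 0 := by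
  have h := theta4_add_half 0 τ
  rw [zero_add] at h
  rwa [h]

theorem theta1_half_add_ne_zero {τ : ℂ} (h0 : theta3 0 τ ≠ 0) : theta1 (1 / 2 + τ / 2) τ ≠ 0 := by
  rw [theta1_add_half_tau]
  exact mul_ne_zero (mul_ne_zero I_ne_zero (Complex.exp_ne_zero _)) (theta4_half_ne_zero h0)

/-- The duplication formula makes `θ₄(x)` a common factor of the quartic relation. It may have
zeros, but it is not identically zero, so the identity theorem cancels it for every `x`. -/
theorem theta4_cubic_444 {τ : ℂ} (hτ : 0 < τ.im) (h0 : theta3 0 τ ≠ 0) (x : ℂ)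
    {a b c : ℂ} (h : a + b + c = 0) :
    theta2 0 τ * theta4 0 (2 * τ) ^ 2 * (theta4 (x + a) τ * theta4 (x + b) τ * theta4 (x + c) τ
      - theta4 (x - a) τ * theta4 (x - b) τ * theta4 (x - c) τ)
      = -(2 * (theta2 x τ * theta3 x τ) * theta1 x τ * (theta1 a τ * theta1 b τ * theta1 c τ)) := by
  have d1 := differentiable_theta1 hτ
  have d2 := differentiable_theta2 hτ
  have d3 := differentiable_theta3 hτ
  have d4 := differentiable_theta4 hτ
  rw [← sub_eq_zero]
  refine eq_zero_of_entire_mul_eq_zero (u := (theta4 · τ)) d4 (f := fun x =>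
    theta2 0 τ * theta4 0 (2 * τ) ^ 2 * (theta4 (x + a) τ * theta4 (x + b) τ * theta4 (x + c) τ
      - theta4 (x - a) τ * theta4 (x - b) τ * theta4 (x - c) τ)
      - -(2 * (theta2 x τ * theta3 x τ) * theta1 x τ * (theta1 a τ * theta1 b τ * theta1 c τ)))
    (by fun_prop) (fun x => ?_) (theta4_half_ne_zero h0) x
  linear_combination theta2 0 τ * theta4 0 (2 * τ) ^ 2 * theta4_quartic_444 hτ x h
    - (theta1 a τ * theta1 b τ * theta1 c τ) * theta1_two_mul hτ x

theorem theta1_cubic_111 {τ : ℂ} (hτ : 0 < τ.im) (h0 : theta3 0 τ ≠ 0) (x : ℂ)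
    {a b c : ℂ} (h : a + b + c = 0) :
    theta2 0 τ * theta4 0 (2 * τ) ^ 2 * (theta1 (x + a) τ * theta1 (x + b) τ * theta1 (x + c) τ
      - theta1 (x - a) τ * theta1 (x - b) τ * theta1 (x - c) τ)
      = 2 * (theta2 x τ * theta3 x τ) * theta4 x τ * (theta1 a τ * theta1 b τ * theta1 c τ) := by
  have d1 := differentiable_theta1 hτ
  have d2 := differentiable_theta2 hτ
  have d3 := differentiable_theta3 hτ
  have d4 := differentiable_theta4 hτ
  rw [← sub_eq_zero]
  refine eq_zero_of_entire_mul_eq_zero (u := (theta1 · τ)) d1 (f := fun x =>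
    theta2 0 τ * theta4 0 (2 * τ) ^ 2 * (theta1 (x + a) τ * theta1 (x + b) τ * theta1 (x + c) τ
      - theta1 (x - a) τ * theta1 (x - b) τ * theta1 (x - c) τ)
      - 2 * (theta2 x τ * theta3 x τ) * theta4 x τ * (theta1 a τ * theta1 b τ * theta1 c τ))
    (by fun_prop) (fun x => ?_) (theta1_half_add_ne_zero h0) x
  linear_combination theta2 0 τ * theta4 0 (2 * τ) ^ 2 * theta1_quartic_111 hτ x h
    + (theta1 a τ * theta1 b τ * theta1 c τ) * theta1_two_mul hτ x

theorem theta1_cubic_144 {τ : ℂ} (hτ : 0 < τ.im) (h0 : theta3 0 τ ≠ 0) (x : ℂ)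
    {a b c : ℂ} (h : a + b + c = 0) :
    theta2 0 τ * theta4 0 (2 * τ) ^ 2 * (theta1 (x + a) τ * theta4 (x + b) τ * theta4 (x + c) τ
      - theta1 (x - a) τ * theta4 (x - b) τ * theta4 (x - c) τ)
      = 2 * (theta2 x τ * theta3 x τ) * theta4 x τ * (theta1 a τ * theta4 b τ * theta4 c τ) := by
  have d1 := differentiable_theta1 hτ
  have d2 := differentiable_theta2 hτ
  have d3 := differentiable_theta3 hτ
  have d4 := differentiable_theta4 hτ
  rw [← sub_eq_zero]
  refine eq_zero_of_entire_mul_eq_zero (u := (theta1 · τ)) d1 (f := fun x =>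
    theta2 0 τ * theta4 0 (2 * τ) ^ 2 * (theta1 (x + a) τ * theta4 (x + b) τ * theta4 (x + c) τ
      - theta1 (x - a) τ * theta4 (x - b) τ * theta4 (x - c) τ)
      - 2 * (theta2 x τ * theta3 x τ) * theta4 x τ * (theta1 a τ * theta4 b τ * theta4 c τ))
    (by fun_prop) (fun x => ?_) (theta1_half_add_ne_zero h0) x
  linear_combination theta2 0 τ * theta4 0 (2 * τ) ^ 2 * theta1_quartic_144 hτ x h
    + (theta1 a τ * theta4 b τ * theta4 c τ) * theta1_two_mul hτ x

theorem theta4_cubic_411 {τ : ℂ} (hτ : 0 < τ.im) (h0 : theta3 0 τ ≠ 0) (x : ℂ)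
    {a b c : ℂ} (h : a + b + c = 0) :
    theta2 0 τ * theta4 0 (2 * τ) ^ 2 * (theta4 (x + a) τ * theta1 (x + b) τ * theta1 (x + c) τ
      - theta4 (x - a) τ * theta1 (x - b) τ * theta1 (x - c) τ)
      = -(2 * (theta2 x τ * theta3 x τ) * theta1 x τ * (theta1 a τ * theta4 b τ * theta4 c τ)) := by
  have d1 := differentiable_theta1 hτ
  have d2 := differentiable_theta2 hτ
  have d3 := differentiable_theta3 hτ
  have d4 := differentiable_theta4 hτ
  rw [← sub_eq_zero]
  refine eq_zero_of_entire_mul_eq_zero (u := (theta4 · τ)) d4 (f := fun x =>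
    theta2 0 τ * theta4 0 (2 * τ) ^ 2 * (theta4 (x + a) τ * theta1 (x + b) τ * theta1 (x + c) τ
      - theta4 (x - a) τ * theta1 (x - b) τ * theta1 (x - c) τ)
      - -(2 * (theta2 x τ * theta3 x τ) * theta1 x τ * (theta1 a τ * theta4 b τ * theta4 c τ)))
    (by fun_prop) (fun x => ?_) (theta4_half_ne_zero h0) x
  linear_combination theta2 0 τ * theta4 0 (2 * τ) ^ 2 * theta4_quartic_411 hτ x h
    - (theta1 a τ * theta4 b τ * theta4 c τ) * theta1_two_mul hτ x

/-! ### Theta constants and the Landen transformation of the leg function -/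

theorem theta2_zero_sq {τ : ℂ} (hτ : 0 < τ.im) :
    theta2 0 τ ^ 2 = 2 * (theta3 0 (2 * τ) * theta2 0 (2 * τ)) := by
  have h := theta2_mul_theta2 0 0 hτ
  rw [add_zero, sub_zero] at h
  linear_combination h

theorem theta3_zero_sq {τ : ℂ} (hτ : 0 < τ.im) :
    theta3 0 τ ^ 2 = theta3 0 (2 * τ) ^ 2 + theta2 0 (2 * τ) ^ 2 := by
  have h := theta3_mul_theta3 0 0 hτ
  rw [add_zero, sub_zero] at h
  linear_combination h

theorem theta4_zero_sq {τ : ℂ} (hτ : 0 < τ.im) :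
    theta4 0 τ ^ 2 = theta3 0 (2 * τ) ^ 2 - theta2 0 (2 * τ) ^ 2 := by
  have h := theta4_mul_theta4 0 0 hτ
  rw [add_zero, sub_zero] at h
  linear_combination h

/-- Jacobi's identity for the theta constants. -/
theorem theta3_zero_pow_four {τ : ℂ} (hτ : 0 < τ.im) :
    theta3 0 τ ^ 4 = theta2 0 τ ^ 4 + theta4 0 τ ^ 4 := by
  have e (x : ℂ) : x ^ 4 = (x ^ 2) ^ 2 := by ring
  rw [e, e (theta2 0 τ), e (theta4 0 τ), theta2_zero_sq hτ, theta3_zero_sq hτ, theta4_zero_sq hτ]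
  ring

/-- This is `cn² = 1 - sn²` without denominators. The companion for `θ₃` is `dn² = 1 - k² sn²`. -/
theorem theta4_zero_sq_mul_theta2_sq {τ : ℂ} (hτ : 0 < τ.im) (x : ℂ) :
    theta4 0 τ ^ 2 * theta2 x τ ^ 2
      = theta2 0 τ ^ 2 * theta4 x τ ^ 2 - theta3 0 τ ^ 2 * theta1 x τ ^ 2 := by
  have h1 := theta1_mul_theta1 x x hτ
  have h2 := theta2_mul_theta2 x x hτ
  have h4 := theta4_mul_theta4 x x hτ
  rw [← sq, sub_self] at h1 h2 h4
  rw [theta2_zero_sq hτ, theta3_zero_sq hτ, theta4_zero_sq hτ, h1, h2, h4]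
  ring

theorem theta4_zero_sq_mul_theta3_sq {τ : ℂ} (hτ : 0 < τ.im) (x : ℂ) :
    theta4 0 τ ^ 2 * theta3 x τ ^ 2
      = theta3 0 τ ^ 2 * theta4 x τ ^ 2 - theta2 0 τ ^ 2 * theta1 x τ ^ 2 := by
  have h1 := theta1_mul_theta1 x x hτ
  have h3 := theta3_mul_theta3 x x hτ
  have h4 := theta4_mul_theta4 x x hτ
  rw [← sq, sub_self] at h1 h3 h4
  rw [theta2_zero_sq hτ, theta3_zero_sq hτ, theta4_zero_sq hτ, h1, h3, h4]
  ring

/-- Landen with second argument `0`: `θ₂ θ₃` and `θ₁ θ₄` of period `2τ` are multiples of `θ₂` and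
`θ₁` of period `τ`, both with the constant `θ₂(0|τ)/2`. -/
theorem theta_leg_product {τ : ℂ} (hτ : 0 < τ.im) (u v : ℂ) :
    theta2 u (2 * τ) * theta3 u (2 * τ) * (theta1 v (2 * τ) * theta4 v (2 * τ))
      = theta2 0 τ ^ 2 / 4 * (theta2 u τ * theta1 v τ) := by
  have h1 := theta1_mul_theta2 v 0 hτ
  have h2 := theta2_mul_theta2 u 0 hτ
  rw [add_zero, sub_zero] at h1 h2
  linear_combination (-theta2 u τ * theta2 0 τ / 4) * h1
    - (theta1 v (2 * τ) * theta4 v (2 * τ) / 2) * h2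

/-! ### Jacobi's imaginary transformation and nonvanishing of theta constants on the imaginary axis.
-/

theorem theta2_zero_functional (τ : ℂ) (hτ : τ ≠ 0) :
    theta2 0 τ = 1 / (-I * τ) ^ (1 / 2 : ℂ) * theta4 0 (-1 / τ) := by
  rw [theta2, theta4, jacobiTheta₂_functional_equation, ← mul_assoc, mul_left_comm,
    ← Complex.exp_add,
    show (Real.pi : ℂ) * I * τ / 4 + Real.pi * I * 0 + -Real.pi * I * (0 + τ / 2) ^ 2 / τ = 0 by
      field_simp; ring, Complex.exp_zero, mul_one,
    show (0 + τ / 2) / τ = 0 + 1 / 2 by field_simp; ring]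

theorem theta3_zero_functional (τ : ℂ) :
    theta3 0 τ = 1 / (-I * τ) ^ (1 / 2 : ℂ) * theta3 0 (-1 / τ) := by
  rw [theta3, theta3, jacobiTheta₂_functional_equation 0 τ]
  simp

/-- For purely imaginary argument and period every term of the series is a positive real
exponential. -/
theorem exists_pos_jacobiTheta₂ (r : ℝ) {t : ℝ} (ht : 0 < t) :
    ∃ x : ℝ, 0 < x ∧ jacobiTheta₂ (r * I) (t * I) = x := by
  have him : 0 < ((t : ℂ) * I).im := by simpa using ht
  have hterm (n : ℤ) : jacobiTheta₂_term n (r * I) (t * I) =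
      ((Real.exp (-2 * Real.pi * n * r - Real.pi * n ^ 2 * t) : ℝ) : ℂ) := by
    rw [jacobiTheta₂_term]
    push_cast
    congr 1
    linear_combination (2 * Real.pi * n * r + Real.pi * n ^ 2 * t : ℂ) * I_sq
  have hs := hasSum_jacobiTheta₂_term (r * I) him
  simp only [hterm] at hs
  have hs' : Summable fun n : ℤ => Real.exp (-2 * Real.pi * n * r - Real.pi * n ^ 2 * t) :=
    Complex.summable_ofReal.mp hs.summable
  refine ⟨_, hs'.tsum_pos (fun n => (Real.exp_pos _).le) 0 (Real.exp_pos _), ?_⟩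
  rw [Complex.ofReal_tsum, hs.tsum_eq]

theorem ellTau_im_pos {t : ℝ} (ht : 0 < t) : 0 < (ellTau t).im := by
  simpa [ellTau] using ht

theorem ellTau_ne_zero {t : ℝ} (ht : 0 < t) : ellTau t ≠ 0 := by
  simp [ellTau, ht.ne']

theorem ellTau_two_mul (t : ℝ) : ellTau (2 * t) = 2 * ellTau t := by
  simp [ellTau, mul_assoc]

theorem neg_one_div_ellTau (t : ℝ) : -1 / ellTau t = ellTau t⁻¹ := by
  rw [ellTau, ellTau, ← div_div, div_I]
  push_cast
  ring

theorem exists_pos_theta3_zero {t : ℝ} (ht : 0 < t) : ∃ x : ℝ, 0 < x ∧ theta3 0 (ellTau t) = x := by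
  simpa [theta3, ellTau] using exists_pos_jacobiTheta₂ 0 ht

theorem exists_pos_theta2_zero {t : ℝ} (ht : 0 < t) :
    ∃ x : ℝ, 0 < x ∧ theta2 0 (ellTau t) = x := by
  obtain ⟨x, hx, h⟩ := exists_pos_jacobiTheta₂ (t / 2) ht
  refine ⟨Real.exp (-(Real.pi * t / 4)) * x, by positivity, ?_⟩
  rw [theta2, ellTau, show 0 + (t : ℂ) * I / 2 = (t / 2 : ℝ) * I by push_cast; ring, h]
  push_cast
  congr 2
  linear_combination (Real.pi * t / 4 : ℂ) * I_sq

theorem theta3_zero_ne_zero {t : ℝ} (ht : 0 < t) : theta3 0 (ellTau t) ≠ 0 := by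
  obtain ⟨x, hx, h⟩ := exists_pos_theta3_zero ht
  rw [h]; exact_mod_cast hx.ne'

theorem theta2_zero_ne_zero {t : ℝ} (ht : 0 < t) : theta2 0 (ellTau t) ≠ 0 := by
  obtain ⟨x, hx, h⟩ := exists_pos_theta2_zero ht
  rw [h]; exact_mod_cast hx.ne'

/-- The series for `θ₄` alternates, so positivity is not visible; the imaginary transformation turns
it into `θ₂` at `1/t`. -/
theorem theta4_zero_ne_zero {t : ℝ} (ht : 0 < t) : theta4 0 (ellTau t) ≠ 0 := by
  have h := theta2_zero_ne_zero (inv_pos.mpr ht)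
  rw [theta2_zero_functional _ (ellTau_ne_zero (inv_pos.mpr ht)), neg_one_div_ellTau,
    inv_inv] at h
  exact right_ne_zero_of_mul h

theorem ellK_ne_zero {t : ℝ} (ht : 0 < t) : ellK t ≠ 0 := by
  have := theta3_zero_ne_zero ht
  simp [ellK, this, Real.pi_ne_zero]

/-! ### Every modulus between `0` and `1` occurs -/

/-- The modulus as a real number. -/
noncomputable def realModulus (t : ℝ) : ℝ := (ellModulus t).re

theorem ofReal_realModulus {t : ℝ} (ht : 0 < t) :
    (realModulus t : ℂ) = ellModulus t ∧ 0 ≤ realModulus t := by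
  obtain ⟨x, hx, h⟩ := exists_pos_theta3_zero ht
  obtain ⟨y, hy, h'⟩ := exists_pos_theta2_zero ht
  have e : ellModulus t = (((y / x) ^ 2 : ℝ) : ℂ) := by
    rw [ellModulus, h, h']; push_cast; rfl
  rw [realModulus, e, ofReal_re]
  exact ⟨rfl, by positivity⟩

theorem ellModulus_eq_inv {t : ℝ} (ht : 0 < t) :
    ellModulus t = (theta4 0 (ellTau t⁻¹) / theta3 0 (ellTau t⁻¹)) ^ 2 := by
  have h : 1 / (-I * ellTau t) ^ (1 / 2 : ℂ) ≠ 0 := by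
    have h3 := theta3_zero_ne_zero ht
    rw [theta3_zero_functional] at h3
    exact left_ne_zero_of_mul h3
  rw [ellModulus, theta2_zero_functional _ (ellTau_ne_zero ht), theta3_zero_functional,
    neg_one_div_ellTau, mul_div_mul_left _ _ h]

/-- The sign `(-1)ⁿ` equals `(-1)^(n²)`, because `n(n - 1)` is even. -/
theorem theta4_zero_eq (τ : ℂ) : theta4 0 τ = jacobiTheta (τ + 1) := by
  rw [theta4, jacobiTheta_eq_jacobiTheta₂, jacobiTheta₂, jacobiTheta₂]
  refine tsum_congr fun n => ?_
  obtain ⟨k, hk⟩ := (Int.even_mul_succ_self (n - 1))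
  rw [jacobiTheta₂_term, jacobiTheta₂_term, Complex.exp_eq_exp_iff_exists_int]
  refine ⟨-k, ?_⟩
  have hk' : ((n : ℂ) - 1) * (n - 1 + 1) = k + k := by exact_mod_cast hk
  push_cast
  linear_combination -(Real.pi * I : ℂ) * hk'

open Filter Topology in
theorem tendsto_jacobiTheta_im_atTop :
    Tendsto jacobiTheta (comap im atTop) (𝓝 1) := by
  have h := isBigO_at_im_infty_jacobiTheta_sub_one
  have h0 : Tendsto (fun τ : ℂ => Real.exp (-Real.pi * τ.im)) (comap im atTop) (𝓝 0) := by
    refine (Real.tendsto_exp_atBot.comp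
      (tendsto_id.const_mul_atTop_of_neg (neg_lt_zero.mpr Real.pi_pos))).comp tendsto_comap
  simpa using (h.trans_tendsto h0).add_const 1

open Filter Topology in
theorem tendsto_theta3_zero : Tendsto (fun t : ℝ => theta3 0 (ellTau t)) atTop (𝓝 1) := by
  simp only [theta3, ← jacobiTheta_eq_jacobiTheta₂]
  refine tendsto_jacobiTheta_im_atTop.comp (tendsto_comap_iff.mpr ?_)
  convert! tendsto_id (α := ℝ) (x := atTop) using 1
  ext t; simp [ellTau]

open Filter Topology in
theorem tendsto_theta4_zero : Tendsto (fun t : ℝ => theta4 0 (ellTau t)) atTop (𝓝 1) := by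
  simp only [theta4_zero_eq]
  refine tendsto_jacobiTheta_im_atTop.comp (tendsto_comap_iff.mpr ?_)
  convert! tendsto_id (α := ℝ) (x := atTop) using 1
  ext t; simp [ellTau]

open Filter Topology in
theorem tendsto_theta_quotient :
    Tendsto (fun t : ℝ => theta4 0 (ellTau t) / theta3 0 (ellTau t)) atTop (𝓝 1) := by
  have h := tendsto_theta4_zero.div tendsto_theta3_zero one_ne_zero
  rwa [div_one] at h

open Filter Topology in
theorem tendsto_realModulus_zero : Tendsto realModulus (𝓝[>] 0) (𝓝 1) := by
  have h := ((tendsto_theta_quotient.pow 2).comp tendsto_inv_nhdsGT_zero)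
  have h' := (continuous_re.tendsto _).comp h
  simp only [one_pow, one_re] at h'
  refine h'.congr' ?_
  filter_upwards [self_mem_nhdsWithin] with t ht
  simp [realModulus, ellModulus_eq_inv ht]

open Filter Topology in
theorem tendsto_realModulus_atTop : Tendsto realModulus atTop (𝓝 0) := by
  have h := (continuous_re.tendsto _).comp ((tendsto_theta_quotient.pow 4).const_sub 1)
  have h2 : Tendsto (fun t => realModulus t ^ 2) atTop (𝓝 0) := by
    simp only [one_pow, sub_self, zero_re] at h
    refine h.congr' ?_
    filter_upwards [eventually_gt_atTop 0] with t ht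
    -- Jacobi's identity gives the complementary modulus, so the same quotient `θ₄/θ₃` governs both
    -- ends of the interval.
    have e : ellModulus t ^ 2 = 1 - (theta4 0 (ellTau t) / theta3 0 (ellTau t)) ^ 4 := by
      have h3 := theta3_zero_ne_zero ht
      rw [ellModulus]
      field_simp
      linear_combination -theta3_zero_pow_four (ellTau_im_pos ht)
    rw [Function.comp_apply, ← e, ← (ofReal_realModulus ht).1, ← ofReal_pow, ofReal_re]
  have h3 := h2.sqrt
  rw [Real.sqrt_zero] at h3
  refine h3.congr' ?_
  filter_upwards [eventually_gt_atTop 0] with t ht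
  exact Real.sqrt_sq (ofReal_realModulus ht).2

theorem continuousOn_realModulus : ContinuousOn realModulus (Set.Ioi 0) := by
  intro t ht
  have hc : ContinuousAt ellTau t := by unfold ellTau; fun_prop
  have h3 : ContinuousAt (fun t : ℝ => theta3 0 (ellTau t)) t :=
    ContinuousAt.comp (g := fun p : ℂ × ℂ => jacobiTheta₂ p.1 p.2) (f := fun t => (0, ellTau t))
      (continuousAt_jacobiTheta₂ 0 (ellTau_im_pos ht)) (by fun_prop)
  have h2 : ContinuousAt (fun t : ℝ => jacobiTheta₂ (0 + ellTau t / 2) (ellTau t)) t :=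
    ContinuousAt.comp (g := fun p : ℂ × ℂ => jacobiTheta₂ p.1 p.2)
      (f := fun t => (0 + ellTau t / 2, ellTau t))
      (continuousAt_jacobiTheta₂ _ (ellTau_im_pos ht)) (by fun_prop)
  have h2' : ContinuousAt (fun t : ℝ => theta2 0 (ellTau t)) t := by
    unfold theta2
    exact .mul (by fun_prop) h2
  exact (continuous_re.continuousAt.comp
    ((h2'.div h3 (theta3_zero_ne_zero ht)).pow 2)).continuousWithinAt

open Filter Topology in
theorem exists_ellModulus_eq {q : ℝ} (hq0 : 0 < q) (hq1 : q < 1) :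
    ∃ t : ℝ, 0 < t ∧ ellModulus t = (q : ℂ) := by
  obtain ⟨a, ha, ha0⟩ := ((tendsto_realModulus_zero.eventually (lt_mem_nhds hq1)).and
    self_mem_nhdsWithin).exists
  obtain ⟨b, hb, hb0⟩ := ((tendsto_realModulus_atTop.eventually (gt_mem_nhds hq0)).and
    (eventually_gt_atTop 0)).exists
  obtain ⟨t, ht, h⟩ := isPreconnected_Ioi.intermediate_value hb0 ha0 continuousOn_realModulus
    ⟨hb.le, ha.le⟩
  exact ⟨t, ht, by rw [← (ofReal_realModulus ht).1, h]⟩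

/-! ### The three-leg form -/

/-- The theta function version of `sn (x + a) - sn y`. -/
noncomputable def snDiff (τ x y : ℂ) : ℂ := theta1 x τ * theta4 y τ - theta4 x τ * theta1 y τ

/-- The Q4 polynomial in homogeneous coordinates. -/
noncomputable def homQ4 (τ x₁ x₂ x₃ x₄ a b : ℂ) : ℂ :=
  theta1 a τ * theta4 b τ * theta4 (a - b) τ *
      (theta1 x₁ τ * theta1 x₂ τ * theta4 x₃ τ * theta4 x₄ τ
        + theta4 x₁ τ * theta4 x₂ τ * theta1 x₃ τ * theta1 x₄ τ)
    - theta4 a τ * theta1 b τ * theta4 (a - b) τ *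
      (theta1 x₁ τ * theta4 x₂ τ * theta4 x₃ τ * theta1 x₄ τ
        + theta4 x₁ τ * theta1 x₂ τ * theta1 x₃ τ * theta4 x₄ τ)
    - theta4 a τ * theta4 b τ * theta1 (a - b) τ *
      (theta1 x₁ τ * theta4 x₂ τ * theta1 x₃ τ * theta4 x₄ τ
        + theta4 x₁ τ * theta1 x₂ τ * theta4 x₃ τ * theta1 x₄ τ)
    + theta1 a τ * theta1 b τ * theta1 (a - b) τ *
      (theta4 x₁ τ * theta4 x₂ τ * theta4 x₃ τ * theta4 x₄ τ
        + theta1 x₁ τ * theta1 x₂ τ * theta1 x₃ τ * theta1 x₄ τ)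

theorem snDiff_three_leg {τ : ℂ} (hτ : 0 < τ.im) (h0 : theta3 0 τ ≠ 0) (x₁ x₂ x₃ x₄ a b : ℂ) :
    theta2 0 τ * theta4 0 (2 * τ) ^ 2 *
      (snDiff τ (x₁ + a) x₂ * snDiff τ (x₁ - b) x₄ * snDiff τ (x₁ - (a - b)) x₃
        - snDiff τ (x₁ - a) x₂ * snDiff τ (x₁ + b) x₄ * snDiff τ (x₁ + (a - b)) x₃)
      = 2 * (theta2 x₁ τ * theta3 x₁ τ) * homQ4 τ x₁ x₂ x₃ x₄ a b := by
  have s1 : a + -b + -(a - b) = 0 := by ring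
  have s2 : -b + a + -(a - b) = 0 := by ring
  have s3 : -(a - b) + a + -b = 0 := by ring
  have e1 := theta4_cubic_444 hτ h0 x₁ s1
  have e2 := theta1_cubic_111 hτ h0 x₁ s1
  have e3 := theta1_cubic_144 hτ h0 x₁ s1
  have e4 := theta1_cubic_144 hτ h0 x₁ s2
  have e5 := theta1_cubic_144 hτ h0 x₁ s3
  have e6 := theta4_cubic_411 hτ h0 x₁ s1
  have e7 := theta4_cubic_411 hτ h0 x₁ s2
  have e8 := theta4_cubic_411 hτ h0 x₁ s3
  simp only [theta1_neg, theta4_neg, sub_neg_eq_add, ← sub_eq_add_neg]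
    at e1 e2 e3 e4 e5 e6 e7 e8
  simp only [snDiff, homQ4]
  -- One cubic relation for each of the eight monomials in the homogeneous coordinates of `x₂, x₃,
  -- x₄`.
  linear_combination (-theta1 x₂ τ * theta1 x₃ τ * theta1 x₄ τ) * e1
    + (theta4 x₂ τ * theta4 x₃ τ * theta4 x₄ τ) * e2
    + (theta4 x₂ τ * theta1 x₃ τ * theta1 x₄ τ) * e3
    + (theta1 x₂ τ * theta1 x₃ τ * theta4 x₄ τ) * e4
    + (theta1 x₂ τ * theta4 x₃ τ * theta1 x₄ τ) * e5
    - (theta1 x₂ τ * theta4 x₃ τ * theta4 x₄ τ) * e6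
    - (theta4 x₂ τ * theta4 x₃ τ * theta1 x₄ τ) * e7
    - (theta4 x₂ τ * theta1 x₃ τ * theta4 x₄ τ) * e8

/-- With `ρ = θ₃(0)/θ₂(0)`, `sn` is `ρ θ₁/θ₄` and `k = ρ⁻²`. Every term of Q4 then carries exactly
`ρ³`, including the one with `k²`. -/
theorem Q4_eq_homQ4 {t : ℝ} (ht : 0 < t) {X₁ X₂ X₃ X₄ α β : ℂ}
    (h₁ : SnFinite t X₁) (h₂ : SnFinite t X₂) (h₃ : SnFinite t X₃) (h₄ : SnFinite t X₄)
    (hα : SnFinite t α) (hβ : SnFinite t β) (hγ : SnFinite t (α - β)) :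
    Q4 t (jacobiSn t X₁) (jacobiSn t X₂) (jacobiSn t X₃) (jacobiSn t X₄) α β *
        (bigTheta4 t X₁ * bigTheta4 t X₂ * bigTheta4 t X₃ * bigTheta4 t X₄ *
          (bigTheta4 t α * bigTheta4 t β * bigTheta4 t (α - β)))
      = (theta3 0 (ellTau t) / theta2 0 (ellTau t)) ^ 3 *
        homQ4 (ellTau t) (X₁ / (2 * ellK t)) (X₂ / (2 * ellK t)) (X₃ / (2 * ellK t))
          (X₄ / (2 * ellK t)) (α / (2 * ellK t)) (β / (2 * ellK t)) := by
  have h3 := theta3_zero_ne_zero ht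
  have h2 := theta2_zero_ne_zero ht
  have eγ : α / (2 * ellK t) - β / (2 * ellK t) = (α - β) / (2 * ellK t) := by ring
  simp only [SnFinite] at h₁ h₂ h₃ h₄ hα hβ hγ
  have e1 (X : ℂ) : theta1 (X / (2 * ellK t)) (ellTau t) = bigTheta1 t X := rfl
  have e4 (X : ℂ) : theta4 (X / (2 * ellK t)) (ellTau t) = bigTheta4 t X := rfl
  simp only [homQ4, eγ, e1, e4]
  simp only [Q4, jacobiSn, ellModulus]
  generalize bigTheta4 t X₁ = a₁ at *
  generalize bigTheta4 t X₂ = a₂ at *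
  generalize bigTheta4 t X₃ = a₃ at *
  generalize bigTheta4 t X₄ = a₄ at *
  generalize bigTheta4 t α = a₅ at *
  generalize bigTheta4 t β = a₆ at *
  generalize bigTheta4 t (α - β) = a₇ at *
  field_simp

theorem legF_eq_theta {t : ℝ} (ht : 0 < t) (X Y A : ℂ) :
    legF (2 * t) X Y A =
      theta2 ((X + Y + A) / 2 / (2 * ellK (2 * t))) (ellTau t) *
          theta1 ((X - Y + A) / 2 / (2 * ellK (2 * t))) (ellTau t) /
        (theta2 ((X + Y - A) / 2 / (2 * ellK (2 * t))) (ellTau t) *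
          theta1 ((X - Y - A) / 2 / (2 * ellK (2 * t))) (ellTau t)) := by
  have h := theta_leg_product (ellTau_im_pos ht)
  have h2 := theta2_zero_ne_zero ht
  simp only [legF, bigTheta1, bigTheta2, bigTheta3, bigTheta4, ellTau_two_mul]
  rw [div_mul_div_comm, h, h, mul_div_mul_left _ _ (by simpa using h2)]

/-- Applying the product formula for `θ₁ θ₂` to the leg in period `τ` leads back to period `2τ`, now
with the arguments `X ± A` and `Y` separated. -/
theorem legF_eq_snDiff {t : ℝ} (ht : 0 < t) (X Y A : ℂ) :
    legF (2 * t) X Y A =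
      snDiff (ellTau (2 * t)) (X / (2 * ellK (2 * t)) + A / (2 * ellK (2 * t)))
          (Y / (2 * ellK (2 * t))) /
        snDiff (ellTau (2 * t)) (X / (2 * ellK (2 * t)) - A / (2 * ellK (2 * t)))
          (Y / (2 * ellK (2 * t))) := by
  have h (x y a : ℂ) : theta2 ((x + y + a) / 2) (ellTau t) * theta1 ((x - y + a) / 2) (ellTau t)
      = snDiff (ellTau (2 * t)) (x + a) y := by
    rw [mul_comm, theta1_mul_theta2 _ _ (ellTau_im_pos ht), snDiff, ellTau_two_mul,
      show (x - y + a) / 2 + (x + y + a) / 2 = x + a by ring,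
      show (x - y + a) / 2 - (x + y + a) / 2 = -y by ring, theta1_neg, theta4_neg]
    ring
  rw [legF_eq_theta ht, ← h, sub_eq_add_neg (X / _) (A / _), ← h]
  ring_nf

theorem div_div_eq_iff_of_ne {a b c d e f : ℂ} (hb : b ≠ 0) (hc : c ≠ 0) (hf : f ≠ 0) :
    a / b / (c / d) = e / f ↔ a * d * f - b * c * e = 0 := by
  rw [div_div_div_eq, div_eq_div_iff (mul_ne_zero hb hc) hf, sub_eq_zero, mul_comm e]

theorem three_leg_core {t : ℝ} (ht : 0 < t) {X₁ X₂ X₃ X₄ α β : ℂ}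
    (h₁ : SnFinite (2 * t) X₁) (h₂ : SnFinite (2 * t) X₂) (h₃ : SnFinite (2 * t) X₃)
    (h₄ : SnFinite (2 * t) X₄) (hα : SnFinite (2 * t) α) (hβ : SnFinite (2 * t) β)
    (hγ : SnFinite (2 * t) (α - β)) (l₂ : legF (2 * t) X₁ X₂ α ≠ 0)
    (l₄ : legF (2 * t) X₁ X₄ β ≠ 0) (l₃ : legF (2 * t) X₁ X₃ (α - β) ≠ 0) :
    ThreeLeg (2 * t) X₁ X₂ X₃ X₄ α β ↔
      bigTheta2 (2 * t) X₁ * bigTheta3 (2 * t) X₁ *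
        Q4 (2 * t) (jacobiSn (2 * t) X₁) (jacobiSn (2 * t) X₂) (jacobiSn (2 * t) X₃)
          (jacobiSn (2 * t) X₄) α β = 0 := by
  have ht2 : 0 < 2 * t := by positivity
  have ht4 : 0 < 2 * (2 * t) := by positivity
  have hQ := Q4_eq_homQ4 ht2 h₁ h₂ h₃ h₄ hα hβ hγ
  have hN := snDiff_three_leg (ellTau_im_pos ht2) (theta3_zero_ne_zero ht2) (X₁ / (2 * ellK (2 * t)))
    (X₂ / (2 * ellK (2 * t))) (X₃ / (2 * ellK (2 * t))) (X₄ / (2 * ellK (2 * t)))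
    (α / (2 * ellK (2 * t))) (β / (2 * ellK (2 * t)))
  have h3 := theta3_zero_ne_zero ht2
  have h2 := theta2_zero_ne_zero ht2
  have h4 := theta4_zero_ne_zero ht4
  rw [ellTau_two_mul] at h4
  rw [ThreeLeg]
  rw [legF_eq_snDiff ht] at l₂ l₃ l₄ ⊢
  rw [legF_eq_snDiff ht, legF_eq_snDiff ht, sub_div]
  rw [sub_div] at l₃
  rw [div_div_eq_iff_of_ne (div_ne_zero_iff.mp l₂).2 (div_ne_zero_iff.mp l₄).1
    (div_ne_zero_iff.mp l₃).2,
    ← mul_eq_zero_iff_left (mul_ne_zero h2 (pow_ne_zero 2 h4)), hN]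
  have hR : (theta3 0 (ellTau (2 * t)) / theta2 0 (ellTau (2 * t))) ^ 3 ≠ 0 :=
    pow_ne_zero 3 (div_ne_zero h3 h2)
  simp only [SnFinite] at h₁ h₂ h₃ h₄ hα hβ hγ
  have hQ0 : homQ4 (ellTau (2 * t)) (X₁ / (2 * ellK (2 * t))) (X₂ / (2 * ellK (2 * t)))
      (X₃ / (2 * ellK (2 * t))) (X₄ / (2 * ellK (2 * t))) (α / (2 * ellK (2 * t)))
      (β / (2 * ellK (2 * t))) = 0 ↔ Q4 (2 * t) (jacobiSn (2 * t) X₁) (jacobiSn (2 * t) X₂)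
        (jacobiSn (2 * t) X₃) (jacobiSn (2 * t) X₄) α β = 0 := by
    rw [← mul_eq_zero_iff_left hR, ← hQ]
    simp [h₁, h₂, h₃, h₄, hα, hβ, hγ]
  rw [mul_eq_zero, mul_eq_zero (b := Q4 _ _ _ _ _ _ _), hQ0, bigTheta2, bigTheta3]
  simp

theorem bigTheta2_ne_zero {t : ℝ} (ht : 0 < t) {X : ℂ} (hX : SnFinite t X)
    (h : jacobiSn t X ^ 2 ≠ 1) : bigTheta2 t X ≠ 0 := by
  intro h2
  apply h
  have e := theta4_zero_sq_mul_theta2_sq (ellTau_im_pos ht) (X / (2 * ellK t))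
  rw [← bigTheta2, ← bigTheta1, ← bigTheta4, h2] at e
  have hz := theta2_zero_ne_zero ht
  rw [SnFinite] at hX
  rw [jacobiSn]
  field_simp
  linear_combination e

theorem bigTheta3_ne_zero {t : ℝ} (ht : 0 < t) {X : ℂ} (hX : SnFinite t X)
    (h : ellModulus t ^ 2 * jacobiSn t X ^ 2 ≠ 1) : bigTheta3 t X ≠ 0 := by
  intro h2
  apply h
  have e := theta4_zero_sq_mul_theta3_sq (ellTau_im_pos ht) (X / (2 * ellK t))
  rw [← bigTheta3, ← bigTheta1, ← bigTheta4, h2] at e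
  have hz := theta2_zero_ne_zero ht
  have hz' := theta3_zero_ne_zero ht
  rw [SnFinite] at hX
  rw [jacobiSn, ellModulus]
  field_simp
  linear_combination e

/-! ### The Laplace type equation -/

theorem legF_neg (t : ℝ) (X Y A : ℂ) : legF t X Y (-A) = (legF t X Y A)⁻¹ := by
  simp only [legF, ← sub_eq_add_neg, sub_neg_eq_add, mul_inv, inv_div]

theorem Q4_swap (t : ℝ) (x₁ x₂ x₃ x₄ α β : ℂ) : Q4 t x₂ x₁ x₄ x₃ α β = Q4 t x₁ x₂ x₃ x₄ α β := by
  simp only [Q4]; ring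

theorem Q4_swap' (t : ℝ) (x₁ x₂ x₃ x₄ α β : ℂ) : Q4 t x₄ x₃ x₂ x₁ α β = Q4 t x₁ x₂ x₃ x₄ α β := by
  simp only [Q4]; ring

theorem laplaceQ4_of_threeLeg {t : ℝ} {α β : ℂ} {X : ℤ → ℤ → ℂ} {m n : ℤ}
    (r : legF t (X m n) (X (m + 1) n) α ≠ 0) (l : legF t (X m n) (X (m - 1) n) α ≠ 0)
    (u : legF t (X m n) (X m (n + 1)) β ≠ 0) (d : legF t (X m n) (X m (n - 1)) β ≠ 0)
    (h₁ : ThreeLeg t (X m n) (X (m + 1) n) (X (m + 1) (n + 1)) (X m (n + 1)) α β)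
    (h₂ : ThreeLeg t (X m n) (X (m - 1) n) (X (m - 1) (n + 1)) (X m (n + 1)) α β)
    (h₃ : ThreeLeg t (X m n) (X (m - 1) n) (X (m - 1) (n - 1)) (X m (n - 1)) α β)
    (h₄ : ThreeLeg t (X m n) (X (m + 1) n) (X (m + 1) (n - 1)) (X m (n - 1)) α β) :
    LaplaceQ4 t α β X m n := by
  rw [ThreeLeg] at h₁ h₂ h₃ h₄
  -- The diagonal legs become `(r/u)(u/l)(l/d)(d/r)`, in terms of the right, upper, left and lower
  -- legs.
  rw [LaplaceQ4, ← neg_sub α β, legF_neg, legF_neg, ← h₁, ← h₂, ← h₃, ← h₄]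
  field_simp

/-! ### Ring patterns -/

theorem theta1_add_tau (z τ : ℂ) :
    theta1 (z + τ) τ = -cexp (-(Real.pi * I * (τ + 2 * z))) * theta1 z τ := by
  have h : cexp (-(Real.pi * I * (τ + 2 * z))) =
      cexp (-(Real.pi * I * τ / 4) - Real.pi * I * (z + τ / 2)) *
        cexp (-(Real.pi * I * τ / 4) - Real.pi * I * z) := by
    rw [← Complex.exp_add]; congr 1; ring
  rw [show z + τ = z + τ / 2 + τ / 2 by ring, theta1_add_half_tau, theta4_add_half_tau, h]
  linear_combination (cexp (-(Real.pi * I * τ / 4) - Real.pi * I * (z + τ / 2)) *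
    cexp (-(Real.pi * I * τ / 4) - Real.pi * I * z) * theta1 z τ) * I_sq

theorem theta4_add_tau (z τ : ℂ) :
    theta4 (z + τ) τ = -cexp (-(Real.pi * I * (τ + 2 * z))) * theta4 z τ := by
  have h : cexp (-(Real.pi * I * (τ + 2 * z))) =
      cexp (-(Real.pi * I * τ / 4) - Real.pi * I * (z + τ / 2)) *
        cexp (-(Real.pi * I * τ / 4) - Real.pi * I * z) := by
    rw [← Complex.exp_add]; congr 1; ring
  rw [show z + τ = z + τ / 2 + τ / 2 by ring, theta4_add_half_tau, theta1_add_half_tau, h]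
  linear_combination (cexp (-(Real.pi * I * τ / 4) - Real.pi * I * (z + τ / 2)) *
    cexp (-(Real.pi * I * τ / 4) - Real.pi * I * z) * theta4 z τ) * I_sq

theorem jacobiSn_add_two_I_mul_ellK' {t : ℝ} (ht : 0 < t) (X : ℂ) :
    jacobiSn t (X + 2 * (I * ellK' t)) = jacobiSn t X := by
  have hK := ellK_ne_zero ht
  have e : (X + 2 * (I * ellK' t)) / (2 * ellK t) = X / (2 * ellK t) + ellTau t := by
    rw [ellK', ellTau]; field_simp
  rw [jacobiSn, bigTheta1, bigTheta4, e, theta1_add_tau, theta4_add_tau,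
    mul_div_mul_left _ _ (neg_ne_zero.mpr (Complex.exp_ne_zero _)), ← bigTheta1, ← bigTheta4,
    ← jacobiSn]

/-- Differences do not see the shift by `iK'`, and in the denominators it adds `2iK'`, a period of
`sn`. -/
theorem hyperbolicRing_iff {t : ℝ} (ht : 0 < t) (c : ℤ → ℤ → ℂ) (m n : ℤ) :
    HyperbolicRing t c m n ↔ SphericalRing t (fun i j => c i j + I * ellK' t) m n := by
  rw [HyperbolicRing, SphericalRing]
  have e (x y : ℂ) : jacobiSn t ((x + y - I * ellK' t) / 2) =
      jacobiSn t ((x + I * ellK' t + (y + I * ellK' t) + I * ellK' t) / 2) := by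
    rw [← jacobiSn_add_two_I_mul_ellK' ht]
    congr 1; ring
  simp only [e, add_sub_add_right_eq_sub]

/-- The quotient of `θ₁` values underlying both a factor of the ring pattern equation and a leg
of the Laplace type equation. -/
noncomputable def ringQuotient (τ p p' : ℂ) : ℂ :=
  theta1 ((p - p') / 2 + τ / 4) τ * theta1 ((p + p') / 2 - τ / 4) τ /
    (theta1 ((p - p') / 2 - τ / 4) τ * theta1 ((p + p') / 2 + τ / 4) τ)

theorem ring_factor_eq {t : ℝ} (ht : 0 < t) (b b' : ℂ) :
    jacobiSn t ((b - b' + I * ellK' t) / 2) / jacobiSn t ((b + b' + I * ellK' t) / 2)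
      = cexp (-(Real.pi * I * (b' / (2 * ellK t)))) *
        ringQuotient (ellTau t) (b / (2 * ellK t)) (b' / (2 * ellK t)) := by
  have hK := ellK_ne_zero ht
  have hρ := div_ne_zero (theta3_zero_ne_zero ht) (theta2_zero_ne_zero ht)
  have e (x : ℂ) : (x + I * ellK' t) / 2 / (2 * ellK t)
      = x / (2 * ellK t) / 2 + ellTau t / 4 := by
    rw [ellK', ellTau]; field_simp; ring
  have e' (w : ℂ) : theta4 (w + ellTau t / 4) (ellTau t) = I * cexp (-(Real.pi * I * w)) *
      theta1 (w - ellTau t / 4) (ellTau t) := by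
    -- Numerator and denominator of `sn` sit at half-period distance, so `θ₄` becomes `θ₁` and only
    -- `θ₁` values remain.
    rw [show w + ellTau t / 4 = w - ellTau t / 4 + ellTau t / 2 by ring, theta4_add_half_tau]
    congr 3; ring
  rw [jacobiSn, jacobiSn, mul_div_mul_left _ _ hρ, bigTheta1, bigTheta1, bigTheta4, bigTheta4,
    e, e, e', e', sub_div, add_div, ringQuotient]
  generalize b / (2 * ellK t) = p
  generalize b' / (2 * ellK t) = p'
  have hexp : cexp (-(Real.pi * I * ((p + p') / 2))) =
      cexp (-(Real.pi * I * p')) * cexp (-(Real.pi * I * ((p - p') / 2))) := by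
    rw [← Complex.exp_add]; congr 1; ring
  rw [hexp]
  generalize theta1 ((p - p') / 2 + ellTau t / 4) (ellTau t) = A
  generalize theta1 ((p - p') / 2 - ellTau t / 4) (ellTau t) = B
  generalize theta1 ((p + p') / 2 + ellTau t / 4) (ellTau t) = C
  generalize theta1 ((p + p') / 2 - ellTau t / 4) (ellTau t) = D
  have h1 := Complex.exp_ne_zero (-(Real.pi * I * ((p - p') / 2)))
  have h2 := I_ne_zero
  simp only [div_eq_mul_inv, mul_inv, inv_inv]
  field_simp

/-- The shift of the variables by `K_k` adds `1/2` to the normalized half-sums, which turns `θ₂`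
into `-θ₁`. -/
theorem legF_scaled {t : ℝ} (ht : 0 < t) (x y a : ℂ) :
    legF (2 * t) (ellK (2 * t) * (1 + 2 * x)) (ellK (2 * t) * (1 + 2 * y)) (2 * ellK (2 * t) * a) =
      theta1 ((x + y + a) / 2) (ellTau t) * theta1 ((x - y + a) / 2) (ellTau t) /
        (theta1 ((x + y - a) / 2) (ellTau t) * theta1 ((x - y - a) / 2) (ellTau t)) := by
  have hK := ellK_ne_zero (show 0 < 2 * t by positivity)
  have e1 (a : ℂ) : (ellK (2 * t) * (1 + 2 * x) + ellK (2 * t) * (1 + 2 * y) +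
      2 * ellK (2 * t) * a) / 2 / (2 * ellK (2 * t)) = (x + y + a) / 2 + 1 / 2 := by
    field_simp; ring
  have e2 (a : ℂ) : (ellK (2 * t) * (1 + 2 * x) - ellK (2 * t) * (1 + 2 * y) +
      2 * ellK (2 * t) * a) / 2 / (2 * ellK (2 * t)) = (x - y + a) / 2 := by
    field_simp; ring
  have e1' := e1 (-a)
  have e2' := e2 (-a)
  rw [mul_neg, ← sub_eq_add_neg, ← sub_eq_add_neg] at e1' e2'
  rw [legF_eq_theta ht, e1, e2, e1', e2', theta2_add_half, theta2_add_half, neg_mul, neg_mul,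
    neg_div_neg_eq]

theorem toQ4Variables_eq {t : ℝ} (ht : 0 < t) (b : ℤ → ℤ → ℂ) (m n : ℤ) :
    toQ4Variables t b m n =
      ellK (2 * t) * (1 + 2 * (b m n / (2 * ellK t) + lineColour m n * ellTau t / 2)) := by
  have hK := ellK_ne_zero ht
  rw [toQ4Variables, ellK', ellTau]
  field_simp

/-- The differences match `ringQuotient` directly. Among the sums one argument is off by a full
period `τ`, in the direction of the sign `ε`; its quasi-period factor gives the exponential. With
inverses of zero equal to zero, the equality also holds when a theta factor vanishes. -/
theorem leg_same_colour {t : ℝ} (ht : 0 < t) {ε : ℂ} (hε : ε = 1 ∨ ε = -1) (p p' : ℂ) :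
    legF (2 * t) (ellK (2 * t) * (1 + 2 * (p + ε * ellTau t / 2)))
        (ellK (2 * t) * (1 + 2 * (p' + ε * ellTau t / 2))) (2 * ellK (2 * t) * (-(ellTau t / 2))) =
      -cexp (Real.pi * I * (p + ε * ellTau t / 2)) *
        (cexp (-(Real.pi * I * p')) * ringQuotient (ellTau t) p p')⁻¹ := by
  rw [legF_scaled ht, ringQuotient]
  generalize ellTau t = τ
  have hexp : cexp (Real.pi * I * (p + ε * τ / 2)) * (cexp (-(Real.pi * I * p')))⁻¹ =
      cexp (Real.pi * I * (p + p' + ε * τ / 2)) := by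
    rw [← Complex.exp_neg, ← Complex.exp_add]; congr 1; ring
  rw [mul_inv, inv_div, ← mul_assoc, neg_mul, hexp,
    show (p + ε * τ / 2 - (p' + ε * τ / 2) + -(τ / 2)) / 2 = (p - p') / 2 - τ / 4 by ring,
    show (p + ε * τ / 2 - (p' + ε * τ / 2) - -(τ / 2)) / 2 = (p - p') / 2 + τ / 4 by ring]
  rcases hε with rfl | rfl
  · rw [show (p + 1 * τ / 2 + (p' + 1 * τ / 2) + -(τ / 2)) / 2 = (p + p') / 2 + τ / 4 by ring,
      show (p + 1 * τ / 2 + (p' + 1 * τ / 2) - -(τ / 2)) / 2 = (p + p') / 2 - τ / 4 + τ by ring,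
      theta1_add_tau, show -(Real.pi * I * (τ + 2 * ((p + p') / 2 - τ / 4))) =
        -(Real.pi * I * (p + p' + 1 * τ / 2)) by ring, Complex.exp_neg]
    simp only [div_eq_mul_inv, mul_inv, inv_inv, inv_neg]
    ring
  · have h := theta1_add_tau ((p + p') / 2 + τ / 4 - τ) τ
    rw [sub_add_cancel, show -(Real.pi * I * (τ + 2 * ((p + p') / 2 + τ / 4 - τ))) =
      -(Real.pi * I * (p + p' + -1 * τ / 2)) by ring, Complex.exp_neg] at h
    rw [show (p + -1 * τ / 2 + (p' + -1 * τ / 2) + -(τ / 2)) / 2 = (p + p') / 2 + τ / 4 - τ by ring,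
      show (p + -1 * τ / 2 + (p' + -1 * τ / 2) - -(τ / 2)) / 2 = (p + p') / 2 - τ / 4 by ring, h]
    have := Complex.exp_ne_zero (Real.pi * I * (p + p' + -1 * τ / 2))
    generalize cexp (Real.pi * I * (p + p' + -1 * τ / 2)) = E at *
    simp only [div_eq_mul_inv, mul_inv]
    field_simp

/-- Opposite colours interchange the roles: the sums match and a difference is off by `τ`, so the
exponential in the central variable appears inverted. -/
theorem leg_other_colour {t : ℝ} (ht : 0 < t) {ε : ℂ} (hε : ε = 1 ∨ ε = -1) (p p' : ℂ) :
    legF (2 * t) (ellK (2 * t) * (1 + 2 * (p + ε * ellTau t / 2)))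
        (ellK (2 * t) * (1 + 2 * (p' + -ε * ellTau t / 2))) (2 * ellK (2 * t) * (ellTau t / 2)) =
      -(cexp (Real.pi * I * (p + ε * ellTau t / 2)))⁻¹ *
        (cexp (-(Real.pi * I * p')) * ringQuotient (ellTau t) p p')⁻¹ := by
  rw [legF_scaled ht, ringQuotient]
  generalize ellTau t = τ
  have hexp : (cexp (Real.pi * I * (p + ε * τ / 2)))⁻¹ * (cexp (-(Real.pi * I * p')))⁻¹ =
      (cexp (Real.pi * I * (p - p' + ε * τ / 2)))⁻¹ := by
    rw [← mul_inv, ← Complex.exp_add]; congr 2; ring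
  rw [mul_inv, inv_div, ← mul_assoc, neg_mul (cexp _)⁻¹, hexp,
    show (p + ε * τ / 2 + (p' + -ε * τ / 2) + τ / 2) / 2 = (p + p') / 2 + τ / 4 by ring,
    show (p + ε * τ / 2 + (p' + -ε * τ / 2) - τ / 2) / 2 = (p + p') / 2 - τ / 4 by ring]
  rcases hε with rfl | rfl
  · rw [show (p + 1 * τ / 2 - (p' + -1 * τ / 2) - τ / 2) / 2 = (p - p') / 2 + τ / 4 by ring,
      show (p + 1 * τ / 2 - (p' + -1 * τ / 2) + τ / 2) / 2 = (p - p') / 2 - τ / 4 + τ by ring,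
      theta1_add_tau, show -(Real.pi * I * (τ + 2 * ((p - p') / 2 - τ / 4))) =
        -(Real.pi * I * (p - p' + 1 * τ / 2)) by ring, Complex.exp_neg]
    simp only [div_eq_mul_inv, mul_inv]
    ring
  · have h := theta1_add_tau ((p - p') / 2 + τ / 4 - τ) τ
    rw [sub_add_cancel, show -(Real.pi * I * (τ + 2 * ((p - p') / 2 + τ / 4 - τ))) =
      -(Real.pi * I * (p - p' + -1 * τ / 2)) by ring, Complex.exp_neg] at h
    rw [show (p + -1 * τ / 2 - (p' + - -1 * τ / 2) - τ / 2) / 2 = (p - p') / 2 + τ / 4 - τ by ring,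
      show (p + -1 * τ / 2 - (p' + - -1 * τ / 2) + τ / 2) / 2 = (p - p') / 2 - τ / 4 by ring, h]
    have := Complex.exp_ne_zero (Real.pi * I * (p - p' + -1 * τ / 2))
    generalize cexp (Real.pi * I * (p - p' + -1 * τ / 2)) = E at *
    simp only [div_eq_mul_inv, mul_inv, inv_neg]
    field_simp

theorem lineColour_eq (m n : ℤ) : lineColour m n = 1 ∨ lineColour m n = -1 := by
  rw [lineColour]; split_ifs <;> simp

theorem lineColour_of_add_eq {m n m' n' : ℤ} (h : m' + n' = m + n) :
    lineColour m' n' = lineColour m n := by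
  rw [lineColour, lineColour, h]

theorem lineColour_neg {m n m' n' : ℤ} (hmn : Even (m + n))
    (h : m' + n' = m + n + 2 ∨ m' + n' = m + n - 2) : lineColour m' n' = -lineColour m n := by
  rw [Int.even_iff] at hmn
  by_cases h4 : 4 ∣ m + n
  · rw [lineColour, lineColour, if_pos h4, if_neg (by omega)]
  · rw [lineColour, lineColour, if_neg h4, if_pos (by omega), neg_neg]

theorem sphericalRing_iff {t : ℝ} (ht : 0 < t) {α β : ℂ} (hαβ : α - β = I * ellK' (2 * t) / 2)
    (b : ℤ → ℤ → ℂ) {m n : ℤ} (hmn : Even (m + n)) :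
    SphericalRing t b m n ↔ LaplaceQ4 (2 * t) α β (toQ4Variables t b) m n := by
  have h1 : α - β = 2 * ellK (2 * t) * (ellTau t / 2) := by
    rw [hαβ, ellK', ellTau]; push_cast; ring
  have h2 : β - α = 2 * ellK (2 * t) * (-(ellTau t / 2)) := by
    rw [← neg_sub, h1]; ring
  have hε := lineColour_eq m n
  rw [LaplaceQ4, SphericalRing, h1, h2]
  simp only [toQ4Variables_eq ht]
  rw [lineColour_neg hmn (m' := m + 1) (n' := n + 1) (by omega),
    lineColour_neg hmn (m' := m - 1) (n' := n - 1) (by omega),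
    lineColour_of_add_eq (show m - 1 + (n + 1) = m + n by ring),
    lineColour_of_add_eq (show m + 1 + (n - 1) = m + n by ring),
    leg_same_colour ht hε, leg_same_colour ht hε, leg_other_colour ht hε, leg_other_colour ht hε]
  simp only [← ring_factor_eq ht]
  have hE := Complex.exp_ne_zero
    (Real.pi * I * (b m n / (2 * ellK t) + lineColour m n * ellTau t / 2))
  generalize cexp (Real.pi * I * (b m n / (2 * ellK t) + lineColour m n * ellTau t / 2)) = E at *
  have hprod (f : ℤ × ℤ → ℂ) : ∏ d ∈ ringDirections, f d =
      f (1, 1) * f (-1, 1) * f (-1, -1) * f (1, -1) := by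
    simp [ringDirections, mul_assoc]
  rw [hprod]
  simp only [← sub_eq_add_neg]
  generalize jacobiSn t ((b m n - b (m + 1) (n + 1) + I * ellK' t) / 2) /
    jacobiSn t ((b m n + b (m + 1) (n + 1) + I * ellK' t) / 2) = A
  generalize jacobiSn t ((b m n - b (m - 1) (n + 1) + I * ellK' t) / 2) /
    jacobiSn t ((b m n + b (m - 1) (n + 1) + I * ellK' t) / 2) = B
  generalize jacobiSn t ((b m n - b (m - 1) (n - 1) + I * ellK' t) / 2) /
    jacobiSn t ((b m n + b (m - 1) (n - 1) + I * ellK' t) / 2) = C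
  generalize jacobiSn t ((b m n - b (m + 1) (n - 1) + I * ellK' t) / 2) /
    jacobiSn t ((b m n + b (m + 1) (n - 1) + I * ellK' t) / 2) = D
  -- Two neighbours lie on the line of the central vertex and two on lines of the other colour, so
  -- `E` and `E⁻¹` each occur twice.
  rw [show -E⁻¹ * A⁻¹ * (-E * B⁻¹) * (-E⁻¹ * C⁻¹) * (-E * D⁻¹) =
    (E * E⁻¹) ^ 2 * (A * B * C * D)⁻¹ by simp only [mul_inv]; ring, mul_inv_cancel₀ hE, one_pow,
    one_mul, inv_eq_one]

theorem mainTheorem10 (q : ℝ) (hq0 : 0 < q) (hq1 : q < 1) :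
    -- a torus with modulus `q` exists
    (∃ t : ℝ, 0 < t ∧ ellModulus t = (q : ℂ)) ∧
    ∀ t : ℝ, 0 < t → ellModulus t = (q : ℂ) →
      -- three-leg form of Q4, on the double cover
      (∀ X₁ X₂ X₃ X₄ α β : ℂ,
        SnFinite (2 * t) X₁ → SnFinite (2 * t) X₂ → SnFinite (2 * t) X₃ → SnFinite (2 * t) X₄ →
        SnFinite (2 * t) α → SnFinite (2 * t) β → SnFinite (2 * t) (α - β) →
        legF (2 * t) X₁ X₂ α ≠ 0 → legF (2 * t) X₁ X₄ β ≠ 0 → legF (2 * t) X₁ X₃ (α - β) ≠ 0 →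
        (Q4 (2 * t) (jacobiSn (2 * t) X₁) (jacobiSn (2 * t) X₂) (jacobiSn (2 * t) X₃)
            (jacobiSn (2 * t) X₄) α β = 0 → ThreeLeg (2 * t) X₁ X₂ X₃ X₄ α β) ∧
        (jacobiSn (2 * t) X₁ ^ 2 ≠ 1 → ellModulus (2 * t) ^ 2 * jacobiSn (2 * t) X₁ ^ 2 ≠ 1 →
          ThreeLeg (2 * t) X₁ X₂ X₃ X₄ α β →
          Q4 (2 * t) (jacobiSn (2 * t) X₁) (jacobiSn (2 * t) X₂) (jacobiSn (2 * t) X₃)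
            (jacobiSn (2 * t) X₄) α β = 0)) ∧
      -- solutions of Q4 on the square grid satisfy the Laplace type equation
      (∀ (α β : ℂ) (X : ℤ → ℤ → ℂ) (m n : ℤ),
        SnFinite (2 * t) α → SnFinite (2 * t) β → SnFinite (2 * t) (α - β) →
        (∀ i ∈ Set.Icc (-1 : ℤ) 1, ∀ j ∈ Set.Icc (-1 : ℤ) 1, SnFinite (2 * t) (X (m + i) (n + j))) →
        legF (2 * t) (X m n) (X (m + 1) n) α ≠ 0 → legF (2 * t) (X m n) (X (m - 1) n) α ≠ 0 →
        legF (2 * t) (X m n) (X m (n + 1)) β ≠ 0 → legF (2 * t) (X m n) (X m (n - 1)) β ≠ 0 →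
        (∀ d ∈ ringDirections,
          legF (2 * t) (X m n) (X (m + d.1) (n + d.2)) (α - β) ≠ 0) →
        Q4Square (2 * t) α β X m n → Q4Square (2 * t) α β X (m - 1) n →
        Q4Square (2 * t) α β X (m - 1) (n - 1) → Q4Square (2 * t) α β X m (n - 1) →
        LaplaceQ4 (2 * t) α β X m n) ∧
      -- the ring pattern equations are the special case in which `α - β` is half of the
      -- imaginary quarter period of the double cover
      (∀ (α β : ℂ), α - β = I * ellK' (2 * t) / 2 →
        ∀ (b : ℤ → ℤ → ℂ) (m n : ℤ), Even (m + n) →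
          (SphericalRing t b m n ↔ LaplaceQ4 (2 * t) α β (toQ4Variables t b) m n)) ∧
      (∀ (α β : ℂ), α - β = I * ellK' (2 * t) / 2 →
        ∀ (c : ℤ → ℤ → ℂ) (m n : ℤ), Even (m + n) →
          (HyperbolicRing t c m n ↔
            LaplaceQ4 (2 * t) α β (toQ4Variables t (fun i j => c i j + I * ellK' t)) m n)) := by
  refine ⟨exists_ellModulus_eq hq0 hq1, fun t ht _ => ⟨?_, ?_, ?_, ?_⟩⟩
  · intro X₁ X₂ X₃ X₄ α β h₁ h₂ h₃ h₄ hα hβ hγ l₂ l₄ l₃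
    have h := three_leg_core ht h₁ h₂ h₃ h₄ hα hβ hγ l₂ l₄ l₃
    have ht2 : 0 < 2 * t := by positivity
    refine ⟨fun hQ => h.mpr (by rw [hQ, mul_zero]), fun hs hks hL => ?_⟩
    exact (mul_eq_zero.mp (h.mp hL)).resolve_left
      (mul_ne_zero (bigTheta2_ne_zero ht2 h₁ hs) (bigTheta3_ne_zero ht2 h₁ hks))
  · intro α β X m n hα hβ hγ hX r l u d hd q₁ q₂ q₃ q₄
    have hX' (i j : ℤ) (hi : i ∈ Set.Icc (-1 : ℤ) 1) (hj : j ∈ Set.Icc (-1 : ℤ) 1)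
        {i' j' : ℤ} (hi' : i' = m + i) (hj' : j' = n + j) : SnFinite (2 * t) (X i' j') := by
      rw [hi', hj']; exact hX i hi j hj
    have x00 := hX' 0 0 (by simp) (by simp) (add_zero m).symm (add_zero n).symm
    have xr := hX' 1 0 (by simp) (by simp) rfl (add_zero n).symm
    have xl := hX' (-1) 0 (by simp) (by simp) (sub_eq_add_neg m 1) (add_zero n).symm
    have xu := hX' 0 1 (by simp) (by simp) (add_zero m).symm rfl
    have xd := hX' 0 (-1) (by simp) (by simp) (add_zero m).symm (sub_eq_add_neg n 1)
    have x₁ := hX' 1 1 (by simp) (by simp) rfl rfl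
    have x₂ := hX' (-1) 1 (by simp) (by simp) (sub_eq_add_neg m 1) rfl
    have x₃ := hX' (-1) (-1) (by simp) (by simp) (sub_eq_add_neg m 1) (sub_eq_add_neg n 1)
    have x₄ := hX' 1 (-1) (by simp) (by simp) rfl (sub_eq_add_neg n 1)
    have d₁ := hd (1, 1) (by simp [ringDirections])
    have d₂ := hd (-1, 1) (by simp [ringDirections])
    have d₃ := hd (-1, -1) (by simp [ringDirections])
    have d₄ := hd (1, -1) (by simp [ringDirections])
    simp only [← sub_eq_add_neg] at d₁ d₂ d₃ d₄
    simp only [Q4Square, sub_add_cancel] at q₁ q₂ q₃ q₄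
    -- Reflecting the squares moves the central vertex into first position while `α` stays on the
    -- horizontal edges.
    rw [← Q4_swap] at q₂ q₃
    rw [← Q4_swap'] at q₃ q₄
    exact laplaceQ4_of_threeLeg r l u d
      ((three_leg_core ht x00 xr x₁ xu hα hβ hγ r u d₁).mpr (by rw [q₁, mul_zero]))
      ((three_leg_core ht x00 xl x₂ xu hα hβ hγ l u d₂).mpr (by rw [q₂, mul_zero]))
      ((three_leg_core ht x00 xl x₃ xd hα hβ hγ l d d₃).mpr (by rw [q₃, mul_zero]))
      ((three_leg_core ht x00 xr x₄ xd hα hβ hγ r d d₄).mpr (by rw [q₄, mul_zero]))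
  · intro α β hαβ b m n hmn
    exact sphericalRing_iff ht hαβ b hmn
  · intro α β hαβ c m n hmn
    rw [hyperbolicRing_iff ht]
    exact sphericalRing_iff ht hαβ _ hmn
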